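/- Two-sample voting on a graph: each vertex holds one of two opinions, and in each synchronous step every vertex independently draws two uniformly random neighbours; if these two hold the same opinion the vertex adopts it, and otherwise it keeps its own. An adversary who knows the graph and everything that has happened so far chooses the initial configuration and, at the beginning of each step, may redistribute the opinions among the vertices arbitrarily without changing the number of vertices holding each opinion (in particular, it may do nothing). Theorem. There are absolute constants $K, C > 0$ and a function $\varepsilon : \mathbb{N} \to \mathbb{R}$ with $\varepsilon(n) \to 0$ as $n \to \infty$ such that the following holds for all integers $n$ and $d \ge 1$ for which a simple $d$-regular graph on $n$ labelled vertices exists, both when the two neighbours are drawn with replacement and when they are drawn without replacement. Let $G$ be uniformly random among all simple $d$-regular graphs on $n$ labelled vertices. Then, with probability at least $1 - \varepsilon(n)$, the graph $G$ has this property: for every initial configuration in which $A$ vertices hold the majority opinion, $B = n - A$ vertices hold the other one, and $$\nu_0 = \frac{|A - B|}{n} \ge K \sqrt{\frac{d}{n} + \frac{1}{d}},$$ for every such adversary and every integer $t \ge C \log n$, with probability at least $1 - \varepsilon(n)$ (over the voting on $G$) all vertices hold the initial majority opinion after $t$ steps. That is, with high probability two-sample voting completes in $O(\log n)$ steps and the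 initial majority wins. -/

import Mathlib

namespace TwoSampleVoting

/-- An assignment of one of two opinions (`true` or `false`) to each vertex. -/
abbrev Config (V : Type*) := V → Bool

/-- The number of vertices that hold opinion `o`. -/
def votes {V : Type*} [Fintype V] (X : Config V) (o : Bool) : ℕ :=
  (Finset.univ.filter fun v => X v = o).card

/-- The imbalance `|A - B| / n` of a configuration, where `A` and `B` are the numbers of vertices
that hold the two opinions and `n` is the number of vertices. -/
noncomputable def imbalance {V : Type*} [Fintype V] (X : Config V) : ℝ :=
  |(votes X true : ℝ) - (votes X false : ℝ)| / (Fintype.card V : ℝ)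

/-- How a vertex draws its sample of two neighbours. -/
inductive Sampling
  | withReplacement
  | withoutReplacement

open Classical in
/-- The set of neighbours of `v`. -/
noncomputable def nbrs {V : Type*} [Fintype V] (G : SimpleGraph V) (v : V) : Finset V :=
  Finset.univ.filter fun w => G.Adj v w

open Classical in
/-- The ordered pairs of neighbours (of distinct neighbours, without replacement) that `v` can
draw. -/
noncomputable def neighbourPairs {V : Type*} [Fintype V] (s : Sampling) (G : SimpleGraph V)
    (v : V) : Finset (V × V) :=
  match s with
  | Sampling.withReplacement => nbrs G v ×ˢ nbrs G v
  | Sampling.withoutReplacement => (nbrs G v).offDiag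

open Classical in
/-- The samples available to `v`: its pairs of neighbours. A vertex with too few neighbours to draw
such a pair draws itself, so it keeps its opinion. -/
noncomputable def samples {V : Type*} [Fintype V] (s : Sampling) (G : SimpleGraph V)
    (v : V) : Finset (V × V) :=
  if (neighbourPairs s G v).Nonempty then neighbourPairs s G v else {(v, v)}

theorem samples_nonempty {V : Type*} [Fintype V] (s : Sampling) (G : SimpleGraph V) (v : V) :
    (samples s G v).Nonempty := by
  unfold samples
  split_ifs with h
  · exact h
  · exact Finset.singleton_nonempty _

open Classical in
theorem piSamples_nonempty {V : Type*} [Fintype V] (s : Sampling) (G : SimpleGraph V) :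
    (Fintype.piFinset (samples s G)).Nonempty :=
  Fintype.piFinset_nonempty.2 (samples_nonempty s G)

open Classical in
/-- The random choices of one round. A uniform element of the product of the sets of available
samples: the vertices draw independently, each one uniformly among its available samples. -/
noncomputable def roundLaw {V : Type*} [Fintype V] (s : Sampling) (G : SimpleGraph V) :
    PMF (V → V × V) :=
  PMF.uniformOfFinset (Fintype.piFinset (samples s G)) (piSamples_nonempty s G)

/-- The synchronous two-sample rule: a vertex whose two samples agree adopts their opinion, any
other vertex keeps its own. -/
def update {V : Type*} (X : Config V) (c : V → V × V) : Config V :=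
  fun v => if X (c v).1 = X (c v).2 then X (c v).1 else X v

/-- An adaptive adversary. At the beginning of each voting step it sees all samples drawn in the
past steps (latest first) and the present configuration, and redistributes the opinions among the
vertices arbitrarily, without changing the number of opinions of each type. -/
structure Adversary (V : Type*) [Fintype V] where
  rearrange : List (V → V × V) → Config V → Config V
  votes_rearrange : ∀ h X o, votes (rearrange h X) o = votes X o

/-- The law of the past samples and of the configuration after `t` steps of two-sample voting on
`G` from `X₀`, against the adversary `adv`. -/
noncomputable def votingLaw {V : Type*} [Fintype V] (s : Sampling) (G : SimpleGraph V)
    (adv : Adversary V) (X₀ : Config V) : ℕ → PMF (List (V → V × V) × Config V)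
  | 0 => PMF.pure ([], X₀)
  | t + 1 => (votingLaw s G adv X₀ t).bind fun p =>
      (roundLaw s G).map fun c => (c :: p.1, update (adv.rearrange p.1 p.2) c)

open Classical in
/-- The set of all `d`-regular simple graphs on the vertices `0, …, n - 1`. -/
noncomputable def regularGraphs (n d : ℕ) : Finset (SimpleGraph (Fin n)) :=
  Finset.univ.filter fun G => G.IsRegularOfDegree d

/-- The uniform random `d`-regular graph on `n` vertices, where there is such a graph. -/
noncomputable def randomRegularGraph (n d : ℕ) (h : (regularGraphs n d).Nonempty) :
    PMF (SimpleGraph (Fin n)) :=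
  PMF.uniformOfFinset (regularGraphs n d) h

/-- The probability of an event under a discrete law. -/
noncomputable def prob {Ω : Type*} (p : PMF Ω) (E : Set Ω) : ℝ :=
  (p.toOuterMeasure E).toReal

end TwoSampleVoting

/-! Give the two opinions the signs `1` and `-1`, let `D` be the lead of the initial majority, `ν =
D / n`, and let `q v` be the mean sign among the neighbours of `v`. The expected sign of `v` after
one round is `q v + sgn (1 + κ)(1 - q v ^ 2) / 2`, where only `κ` depends on the sampling rule
(`meanSgn_eq`). On a regular graph the `q v` sum to `D`, so the drift of the lead is governed by `∑
sgn (1 - q v ^ 2)`.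

If the graph has small discrepancy, `q v` is close to `ν` on average, and the lead grows by a
constant factor as long as `ν` exceeds a multiple of the discrepancy and stays away from `1`
(`le_sum_meanSgn_of_discrepancy`). Once the minority is small, sparsity of small sets keeps the
minority and the vertices exposed to it nearly free of internal edges, and the minority halves in
expectation (`le_sum_meanSgn_of_sparse`). Both bounds depend on a configuration only through its
vote counts, which the adversary cannot alter. Chebyshev's inequality makes each round succeed with
probability `1 - O(1 / √n)`, and a chain of potentials (`expectAt_failure_le`) adds the errors over
`O(log n)` rounds.

Both graph properties come from switchings: a prescribed set of `k` edges has probability at most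
about `(d / n) ^ k` (`card_regularContaining_le`). Binomial moments turn this into upper tails for
edge counts, strong enough for union bounds over all pairs of sets and over all small sets
(`card_not_good`). -/

namespace TwoSampleVoting

open Finset
open scoped BigOperators ENNReal

/-! ### Switchings of regular graphs. -/

section Switching

variable {V : Type*}

theorem mem_nbrs [Fintype V] {G : SimpleGraph V} {v w : V} : w ∈ nbrs G v ↔ G.Adj v w := by
  simp [nbrs]

theorem mem_regularGraphs {n d : ℕ} {G : SimpleGraph (Fin n)} :
    G ∈ regularGraphs n d ↔ ∀ v, (nbrs G v).card = d := by
  classical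
  unfold regularGraphs
  rw [mem_filter]
  simp only [mem_univ, true_and, SimpleGraph.IsRegularOfDegree]
  refine forall_congr' fun v => ?_
  rw [← SimpleGraph.card_neighborFinset_eq_degree]
  have : G.neighborFinset v = nbrs G v := by
    ext w; simp [mem_nbrs]
  rw [this]

/-- Replace the edges `uv` and `xy` by `ux` and `vy`. -/
def switch (G : SimpleGraph V) (u v x y : V) : SimpleGraph V :=
  SimpleGraph.fromEdgeSet ((G.edgeSet \ {s(u, v), s(x, y)}) ∪ {s(u, x), s(v, y)})

/-- The switching of `uv` and `xy` to `ux` and `vy` is possible in `G`. -/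
structure CanSwitch (G : SimpleGraph V) (u v x y : V) : Prop where
  uv : G.Adj u v
  xy : G.Adj x y
  ux : ¬ G.Adj u x
  vy : ¬ G.Adj v y
  neux : u ≠ x
  nevy : v ≠ y

theorem switch_edgeSet {G : SimpleGraph V} {u v x y : V} (h : CanSwitch G u v x y) :
    (switch G u v x y).edgeSet = (G.edgeSet \ {s(u, v), s(x, y)}) ∪ {s(u, x), s(v, y)} := by
  rw [switch, SimpleGraph.edgeSet_fromEdgeSet, sdiff_eq_left]
  rw [Set.disjoint_left]
  rintro e (he | he)
  · exact G.not_isDiag_of_mem_edgeSet he.1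
  · rcases he with rfl | rfl
    · simpa using h.neux
    · simpa using h.nevy

/-- A switching is undone by the opposite exchange, so `G` is recovered from its image and `u, v, x,
y`. This gives the injectivity behind the double count. -/
theorem edgeSet_eq_of_switch {G : SimpleGraph V} {u v x y : V} (h : CanSwitch G u v x y) :
    G.edgeSet = ((switch G u v x y).edgeSet \ {s(u, x), s(v, y)}) ∪ {s(u, v), s(x, y)} := by
  rw [switch_edgeSet h]
  ext e
  have h1 : e = s(u, v) → e ∈ G.edgeSet := by rintro rfl; exact h.uv
  have h2 : e = s(x, y) → e ∈ G.edgeSet := by rintro rfl; exact h.xy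
  have h3 : e = s(u, x) → e ∉ G.edgeSet := by rintro rfl; exact h.ux
  have h4 : e = s(v, y) → e ∉ G.edgeSet := by rintro rfl; exact h.vy
  simp only [Set.mem_union, Set.mem_sdiff, Set.mem_insert_iff, Set.mem_singleton_iff]
  tauto

theorem sum_sym2_indicator [Fintype V] [DecidableEq V] {u v : V} (h : u ≠ v) (a : V) :
    ∑ b, (if s(a, b) = s(u, v) then (1 : ℤ) else 0)
      = (if a = u then 1 else 0) + (if a = v then 1 else 0) := by
  have : ∀ b, (if s(a, b) = s(u, v) then (1 : ℤ) else 0)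
      = (if a = u then (if b = v then 1 else 0) else 0)
        + (if a = v then (if b = u then 1 else 0) else 0) := by
    intro b
    simp only [Sym2.eq_iff]
    by_cases h1 : a = u <;> by_cases h2 : a = v <;> by_cases h3 : b = u <;> by_cases h4 : b = v <;>
      simp_all
  simp only [this, sum_add_distrib]
  split_ifs <;> simp

theorem indicator_exchange {α : Type*} [DecidableEq α] (S : Set α) [DecidablePred (· ∈ S)]
    {e₁ e₂ e₃ e₄ : α} (h1 : e₁ ∈ S) (h2 : e₂ ∈ S) (h3 : e₃ ∉ S) (h4 : e₄ ∉ S) (h12 : e₁ ≠ e₂)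
    (h34 : e₃ ≠ e₄) [DecidablePred (· ∈ S \ {e₁, e₂} ∪ {e₃, e₄})] (e : α) :
    (if e ∈ S \ {e₁, e₂} ∪ {e₃, e₄} then (1 : ℤ) else 0)
      = (if e ∈ S then 1 else 0) - (if e = e₁ then 1 else 0) - (if e = e₂ then 1 else 0)
        + (if e = e₃ then 1 else 0) + (if e = e₄ then 1 else 0) := by
  have h13 : e₁ ≠ e₃ := by rintro rfl; exact h3 h1
  have h14 : e₁ ≠ e₄ := by rintro rfl; exact h4 h1
  have h23 : e₂ ≠ e₃ := by rintro rfl; exact h3 h2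
  have h24 : e₂ ≠ e₄ := by rintro rfl; exact h4 h2
  by_cases c1 : e = e₁
  · subst c1; simp [*]
  by_cases c2 : e = e₂
  · subst c2; simp [*]
  by_cases c3 : e = e₃
  · subst c3; simp [*]
  by_cases c4 : e = e₄
  · subst c4; simp [*]
  simp [*]

/-- Each of the four vertices loses one edge and gains one. Signed edge indicators avoid a case
split on the position of `a`. -/
theorem card_nbrs_switch [Fintype V] {G : SimpleGraph V} {u v x y : V} (h : CanSwitch G u v x y) (a : V) :
    (nbrs (switch G u v x y) a).card = (nbrs G a).card := by
  classical
  have h12 : s(u, v) ≠ s(x, y) := by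
    intro h'
    rw [Sym2.eq_iff] at h'
    rcases h' with ⟨h', -⟩ | ⟨-, h'⟩
    · exact h.neux h'
    · exact h.ux (h' ▸ h.uv)
  have h34 : s(u, x) ≠ s(v, y) := by
    intro h'
    rw [Sym2.eq_iff] at h'
    rcases h' with ⟨h', -⟩ | ⟨-, h'⟩
    · exact h.uv.ne h'
    · exact h.ux (h' ▸ h.uv)
  have key : ∀ b, (if (switch G u v x y).Adj a b then (1 : ℤ) else 0)
      = (if G.Adj a b then 1 else 0) - (if s(a, b) = s(u, v) then 1 else 0)
        - (if s(a, b) = s(x, y) then 1 else 0) + (if s(a, b) = s(u, x) then 1 else 0)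
        + (if s(a, b) = s(v, y) then 1 else 0) := by
    intro b
    simp only [← SimpleGraph.mem_edgeSet, switch_edgeSet h]
    exact indicator_exchange G.edgeSet h.uv h.xy h.ux h.vy h12 h34 s(a, b)
  have hc : ∀ G' : SimpleGraph V, ((nbrs G' a).card : ℤ) = ∑ b, if G'.Adj a b then (1 : ℤ) else 0 := by
    intro G'
    simp [nbrs]
  have : ((nbrs (switch G u v x y) a).card : ℤ) = (nbrs G a).card := by
    rw [hc, hc]
    simp only [key, sum_add_distrib, sum_sub_distrib]
    rw [sum_sym2_indicator h.uv.ne, sum_sym2_indicator h.xy.ne, sum_sym2_indicator h.neux,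
      sum_sym2_indicator h.nevy]
    ring
  exact_mod_cast this

end Switching

/-! ### Probability of prescribed edges, and upper tails of edge counts. -/

open Classical in
/-- The `d`-regular graphs on `n` vertices that contain all edges in `F`. -/
noncomputable def regularContaining (n d : ℕ) (F : Finset (Sym2 (Fin n))) :
    Finset (SimpleGraph (Fin n)) :=
  (regularGraphs n d).filter fun G => ∀ e ∈ F, e ∈ G.edgeSet

open Classical in
/-- The pairs `(x, y)` for which `uv` and `xy` can be switched without losing an edge of `F`. -/
noncomputable def switchPairs {n : ℕ} (G : SimpleGraph (Fin n)) (F : Finset (Sym2 (Fin n)))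
    (u v : Fin n) : Finset (Fin n × Fin n) :=
  univ.filter fun p => CanSwitch G u v p.1 p.2 ∧ s(p.1, p.2) ∉ F

theorem card_adj_pairs {n d : ℕ} {G : SimpleGraph (Fin n)} (hG : ∀ v, (nbrs G v).card = d)
    (S : Finset (Fin n)) : (S.sigma fun v => nbrs G v).card = S.card * d := by
  rw [card_sigma, sum_congr rfl fun v _ => hG v, sum_const, smul_eq_mul]

/-- Among the `n * d` ordered adjacent pairs `(x, y)`, a switching is ruled out only when the edge
lies in `F`, or `x` equals or neighbours `u`, or `y` equals or neighbours `v`. -/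
theorem le_card_switchPairs {n d : ℕ} {G : SimpleGraph (Fin n)} (hG : ∀ v, (nbrs G v).card = d)
    (F : Finset (Sym2 (Fin n))) {u v : Fin n} (huv : G.Adj u v) :
    n * d ≤ (switchPairs G F u v).card + 2 * F.card + 2 * (d * (d + 1)) := by
  classical
  set P : Finset (Fin n × Fin n) := univ.filter fun p => G.Adj p.1 p.2 with hP
  have hPc : P.card = n * d := by
    have h := card_adj_pairs hG univ
    rw [card_univ, Fintype.card_fin] at h
    rw [← h]
    refine card_bij' (fun p _ => ⟨p.1, p.2⟩) (fun q _ => (q.1, q.2)) ?_ ?_ ?_ ?_ <;>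
      simp [hP, mem_nbrs]
  set P1 : Finset (Fin n × Fin n) := univ.filter fun p => s(p.1, p.2) ∈ F with hP1
  have hP1c : P1.card ≤ 2 * F.card := by
    refine card_le_mul_card_image_of_maps_to (f := fun p : Fin n × Fin n => s(p.1, p.2)) ?_ 2 ?_
    · intro p hp; simpa [hP1] using hp
    · intro e _
      induction e with
      | _ a b =>
        refine (card_le_card (t := {(a, b), (b, a)}) ?_).trans card_le_two
        intro p hp
        simp only [mem_filter, Sym2.eq_iff] at hp
        simp only [mem_insert, mem_singleton, Prod.ext_iff]
        exact hp.2
  set P2 : Finset (Fin n × Fin n) := P.filter fun p => p.1 ∈ insert u (nbrs G u) with hP2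
  set P3 : Finset (Fin n × Fin n) := P.filter fun p => p.2 ∈ insert v (nbrs G v) with hP3
  have hins : ∀ w, (insert w (nbrs G w)).card ≤ d + 1 := fun w => by
    rw [← hG w]; exact card_insert_le _ _
  have hP2c : P2.card ≤ d * (d + 1) := by
    calc P2.card ≤ ((insert u (nbrs G u)).sigma fun v => nbrs G v).card := by
          refine card_le_card_of_injOn (fun p => ⟨p.1, p.2⟩) ?_ ?_
          · intro p hp
            simp only [hP2, hP, coe_filter, mem_filter, mem_univ, true_and, Set.mem_ofPred_eq] at hp
            simp only [coe_sigma, Set.mem_sigma_iff, mem_coe]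
            exact ⟨hp.2, mem_nbrs.2 hp.1⟩
          · rintro ⟨a, b⟩ _ ⟨a', b'⟩ _ h
            simpa using h
      _ ≤ d * (d + 1) := by
          rw [card_adj_pairs hG, mul_comm]
          exact Nat.mul_le_mul_left _ (hins u)
  have hP3c : P3.card ≤ d * (d + 1) := by
    calc P3.card ≤ ((insert v (nbrs G v)).sigma fun v => nbrs G v).card := by
          refine card_le_card_of_injOn (fun p => ⟨p.2, p.1⟩) ?_ ?_
          · intro p hp
            simp only [hP3, hP, coe_filter, mem_filter, mem_univ, true_and, Set.mem_ofPred_eq] at hp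
            simp only [coe_sigma, Set.mem_sigma_iff, mem_coe]
            exact ⟨hp.2, mem_nbrs.2 hp.1.symm⟩
          · rintro ⟨a, b⟩ _ ⟨a', b'⟩ _ h
            simp at h ⊢
            tauto
      _ ≤ d * (d + 1) := by
          rw [card_adj_pairs hG, mul_comm]
          exact Nat.mul_le_mul_left _ (hins v)
  have hsub : P ⊆ switchPairs G F u v ∪ P1 ∪ P2 ∪ P3 := by
    intro p hp
    have hp' : G.Adj p.1 p.2 := by simpa [hP] using hp
    by_contra hn
    simp only [mem_union, not_or, hP1, hP2, hP3, mem_filter, hp, mem_univ, true_and, mem_insert,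
      mem_nbrs, switchPairs, not_and] at hn
    obtain ⟨⟨⟨h1, h2⟩, h3⟩, h4⟩ := hn
    push Not at h1
    exact h2 (h1 ⟨huv, hp', h3.2, h4.2, fun h => h3.1 h.symm, fun h => h4.1 h.symm⟩)
  have h1 := card_le_card hsub
  have h2 := card_union_le (switchPairs G F u v ∪ P1 ∪ P2) P3
  have h3 := card_union_le (switchPairs G F u v ∪ P1) P2
  have h4 := card_union_le (switchPairs G F u v) P1
  omega

/-- Double counting of switchings that destroy `e = uv` and keep `F`. In the new graph `x` is a
neighbour of `u` and `y` one of `v`, so each target arises at most `d ^ 2` times. -/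
theorem card_regularContaining_insert {n d : ℕ} (F : Finset (Sym2 (Fin n))) (e : Sym2 (Fin n))
    (he : e ∉ F) :
    (regularContaining n d (insert e F)).card
        * (n * d - 2 * (F.card + 1) - 2 * (d * (d + 1)))
      ≤ (regularContaining n d F).card * d ^ 2 := by
  classical
  induction e with
  | _ u v =>
  set F' := insert s(u, v) F with hF'
  have hmem : ∀ G ∈ regularContaining n d F', (∀ w, (nbrs G w).card = d) ∧ G.Adj u v ∧
      ∀ e ∈ F, e ∈ G.edgeSet := by
    intro G hG
    simp only [regularContaining, mem_filter, mem_regularGraphs, hF', mem_insert,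
      forall_eq_or_imp] at hG
    exact ⟨hG.1, hG.2.1, hG.2.2⟩
  have hlow : (regularContaining n d F').card * (n * d - 2 * (F.card + 1) - 2 * (d * (d + 1)))
      ≤ ((regularContaining n d F').sigma fun G => switchPairs G F' u v).card := by
    rw [card_sigma, ← smul_eq_mul]
    refine card_nsmul_le_sum _ _ _ fun G hG => ?_
    have h1 := le_card_switchPairs (hmem G hG).1 F' (hmem G hG).2.1
    have h2 : F'.card = F.card + 1 := card_insert_of_notMem he
    omega
  have hup : ((regularContaining n d F).sigma fun G => nbrs G u ×ˢ nbrs G v).card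
      = (regularContaining n d F).card * d ^ 2 := by
    rw [card_sigma, ← smul_eq_mul]
    refine sum_const_nat fun G hG => ?_
    simp only [regularContaining, mem_filter, mem_regularGraphs] at hG
    rw [card_product, hG.1, hG.1, sq]
  refine hlow.trans (le_trans ?_ hup.le)
  refine card_le_card_of_injOn (fun a => ⟨switch a.1 u v a.2.1 a.2.2, a.2⟩) ?_ ?_
  · rintro ⟨G, x, y⟩ ha
    simp only [coe_sigma, Set.mem_sigma_iff, mem_coe] at ha ⊢
    obtain ⟨hG, hp⟩ := ha
    simp only [switchPairs, mem_filter, mem_univ, true_and] at hp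
    obtain ⟨hs, hxy⟩ := hp
    have hes := switch_edgeSet hs
    refine ⟨?_, ?_⟩
    · simp only [regularContaining, mem_filter, mem_regularGraphs]
      refine ⟨fun w => (card_nbrs_switch hs w).trans ((hmem G hG).1 w), fun e heF => ?_⟩
      rw [hes]
      refine Or.inl ⟨(hmem G hG).2.2 e heF, ?_⟩
      rintro (rfl | h)
      · exact he heF
      · exact hxy (h ▸ mem_insert_of_mem heF)
    · rw [mem_product, mem_nbrs, mem_nbrs, ← SimpleGraph.mem_edgeSet, ← SimpleGraph.mem_edgeSet, hes]
      simp
  · rintro ⟨G, x, y⟩ ha ⟨G', x', y'⟩ ha' h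
    simp only [Sigma.mk.injEq, heq_eq_eq, Prod.mk.injEq] at h
    obtain ⟨h, rfl, rfl⟩ := h
    simp only [coe_sigma, Set.mem_sigma_iff, mem_coe, switchPairs, mem_filter, mem_univ,
      true_and] at ha ha'
    have : G = G' := by
      rw [← SimpleGraph.edgeSet_inj, edgeSet_eq_of_switch ha.2.1, edgeSet_eq_of_switch ha'.2.1, h]
    subst this
    rfl

theorem card_regularContaining_le {n d : ℕ} (k : ℕ) (F : Finset (Sym2 (Fin n)))
    (hF : F.card ≤ k) :
    (regularContaining n d F).card * (n * d - 2 * k - 2 * (d * (d + 1))) ^ F.card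
      ≤ (regularGraphs n d).card * (d ^ 2) ^ F.card := by
  classical
  induction F using Finset.induction_on with
  | empty =>
    simp only [card_empty, pow_zero, mul_one]
    exact card_filter_le _ _
  | insert e F he ih =>
    have hc : (insert e F).card = F.card + 1 := card_insert_of_notMem he
    rw [hc] at hF ⊢
    have h1 := card_regularContaining_insert (d := d) F e he
    have h2 := ih (by omega)
    set M := n * d - 2 * k - 2 * (d * (d + 1))
    have hM : M ≤ n * d - 2 * (F.card + 1) - 2 * (d * (d + 1)) := by omega
    calc (regularContaining n d (insert e F)).card * M ^ (F.card + 1)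
        = ((regularContaining n d (insert e F)).card * M) * M ^ F.card := by ring
      _ ≤ ((regularContaining n d F).card * d ^ 2) * M ^ F.card :=
          Nat.mul_le_mul_right _ ((Nat.mul_le_mul_left _ hM).trans h1)
      _ = ((regularContaining n d F).card * M ^ F.card) * d ^ 2 := by ring
      _ ≤ ((regularGraphs n d).card * (d ^ 2) ^ F.card) * d ^ 2 := Nat.mul_le_mul_right _ h2
      _ = _ := by ring

open Classical in
/-- The number of edges of `G` in `H`. -/
noncomputable def edgesIn {n : ℕ} (G : SimpleGraph (Fin n)) (H : Finset (Sym2 (Fin n))) : ℕ :=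
  (H.filter fun e => e ∈ G.edgeSet).card

/-- Upper tail of the number of edges that a random regular graph has in a given set. -/
theorem card_edgesIn_ge {n d : ℕ} (H : Finset (Sym2 (Fin n))) (m k : ℕ) :
    ((regularGraphs n d).filter fun G => m ≤ edgesIn G H).card
        * ((m + 1 - k) ^ k * (n * d - 2 * k - 2 * (d * (d + 1))) ^ k)
      ≤ (regularGraphs n d).card * (H.card * d ^ 2) ^ k := by
  classical
  set M := n * d - 2 * k - 2 * (d * (d + 1)) with hM
  set R := regularGraphs n d with hR
  -- Binomial moment method: the `k`-subsets of `H` contained in the graph are counted in two ways,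
  -- and Markov's inequality is applied to `(edgesIn G H).choose k`.
  have hdc : ∑ G ∈ R, (edgesIn G H).choose k
      = ∑ F ∈ H.powersetCard k, (regularContaining n d F).card := by
    have h := sum_card_bipartiteAbove_eq_sum_card_bipartiteBelow (s := R) (t := H.powersetCard k)
      (fun G F => ∀ e ∈ F, e ∈ G.edgeSet)
    have h1 : ∀ G, (edgesIn G H).choose k
        = (bipartiteAbove (fun (G : SimpleGraph (Fin n)) (F : Finset (Sym2 (Fin n))) =>
            ∀ e ∈ F, e ∈ G.edgeSet) (H.powersetCard k) G).card := by
      intro G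
      rw [edgesIn, ← card_powersetCard]
      congr 1
      ext F
      simp only [mem_powersetCard, mem_bipartiteAbove, subset_iff, mem_filter]
      constructor
      · rintro ⟨h, h'⟩; exact ⟨⟨fun e he => (h he).1, h'⟩, fun e he => (h he).2⟩
      · rintro ⟨⟨h, h'⟩, h''⟩; exact ⟨fun e he => ⟨h he, h'' e he⟩, h'⟩
    simp only [h1]
    rw [h]
    rfl
  have h1 : (R.filter fun G => m ≤ edgesIn G H).card * m.choose k
      ≤ ∑ G ∈ R, (edgesIn G H).choose k := by
    calc _ ≤ ∑ G ∈ R.filter (fun G => m ≤ edgesIn G H), (edgesIn G H).choose k := by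
          rw [← smul_eq_mul]
          refine card_nsmul_le_sum _ _ _ fun G hG => ?_
          exact Nat.choose_le_choose k (mem_filter.1 hG).2
      _ ≤ _ := sum_le_sum_of_subset (filter_subset _ _)
  have h2 : (∑ G ∈ R, (edgesIn G H).choose k) * M ^ k
      ≤ H.card.choose k * (R.card * (d ^ 2) ^ k) := by
    rw [hdc, sum_mul, ← card_powersetCard, ← smul_eq_mul]
    refine sum_le_card_nsmul _ _ _ fun F hF => ?_
    have hc := (mem_powersetCard.1 hF).2
    have := card_regularContaining_le (d := d) k F hc.le
    rwa [hc] at this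
  have h3 : (m + 1 - k) ^ k ≤ k.factorial * m.choose k := by
    rw [← Nat.descFactorial_eq_factorial_mul_choose]
    exact Nat.pow_sub_le_descFactorial m k
  have h4 : k.factorial * H.card.choose k ≤ H.card ^ k := by
    rw [← Nat.descFactorial_eq_factorial_mul_choose]
    exact Nat.descFactorial_le_pow _ _
  set N := (R.filter fun G => m ≤ edgesIn G H).card
  calc N * ((m + 1 - k) ^ k * M ^ k)
      ≤ N * ((k.factorial * m.choose k) * M ^ k) := by gcongr
    _ = k.factorial * ((N * m.choose k) * M ^ k) := by ring
    _ ≤ k.factorial * (H.card.choose k * (R.card * (d ^ 2) ^ k)) := by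
        exact Nat.mul_le_mul_left _ ((Nat.mul_le_mul_right _ h1).trans h2)
    _ = (k.factorial * H.card.choose k) * (R.card * (d ^ 2) ^ k) := by ring
    _ ≤ H.card ^ k * (R.card * (d ^ 2) ^ k) := by gcongr
    _ = _ := by rw [mul_pow]; ring

theorem sub_le_cast_sub (a b : ℕ) : (a : ℝ) - b ≤ ((a - b : ℕ) : ℝ) := by
  rw [sub_le_iff_le_add]
  exact_mod_cast (le_tsub_add : a ≤ a - b + b)

theorem card_edgesIn_ge_real {n d : ℕ} (H : Finset (Sym2 (Fin n))) {x M r : ℝ} (k : ℕ)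
    (hM : 0 < M) (hMle : M ≤ n * d - 2 * k - 2 * (d * (d + 1))) (hxk : k < x)
    (hr : H.card * (d : ℝ) ^ 2 ≤ r * ((x - k) * M)) :
    (((regularGraphs n d).filter fun G => x ≤ edgesIn G H).card : ℝ)
      ≤ r ^ k * (regularGraphs n d).card := by
  classical
  have h := card_edgesIn_ge (d := d) H ⌈x⌉₊ k
  have hfil : ((regularGraphs n d).filter fun G => x ≤ edgesIn G H)
      = (regularGraphs n d).filter fun G => ⌈x⌉₊ ≤ edgesIn G H := by
    ext G; simp only [mem_filter, Nat.ceil_le]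
  rw [hfil]
  set N := ((regularGraphs n d).filter fun G => ⌈x⌉₊ ≤ edgesIn G H).card
  have h' : (N : ℝ) * (((⌈x⌉₊ + 1 - k : ℕ) : ℝ) ^ k
      * ((n * d - 2 * k - 2 * (d * (d + 1)) : ℕ) : ℝ) ^ k)
      ≤ (regularGraphs n d).card * (H.card * (d : ℝ) ^ 2) ^ k := by exact_mod_cast h
  have h1 : x - k ≤ ((⌈x⌉₊ + 1 - k : ℕ) : ℝ) := by
    refine le_trans ?_ (sub_le_cast_sub _ _)
    push_cast
    linarith [Nat.le_ceil x]
  have h2 : M ≤ ((n * d - 2 * k - 2 * (d * (d + 1)) : ℕ) : ℝ) := by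
    have e1 := sub_le_cast_sub (n * d - 2 * k) (2 * (d * (d + 1)))
    have e2 := sub_le_cast_sub (n * d) (2 * k)
    push_cast at e1 e2
    linarith
  have hpos : 0 < (x - k) * M := mul_pos (by linarith) hM
  have h3 : (N : ℝ) * ((x - k) * M) ^ k ≤ (r ^ k * (regularGraphs n d).card) * ((x - k) * M) ^ k := by
    calc (N : ℝ) * ((x - k) * M) ^ k ≤ (N : ℝ) * (((⌈x⌉₊ + 1 - k : ℕ) : ℝ) ^ k
          * ((n * d - 2 * k - 2 * (d * (d + 1)) : ℕ) : ℝ) ^ k) := by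
          rw [mul_pow]
          have : 0 ≤ x - k := by linarith
          gcongr
      _ ≤ (regularGraphs n d).card * (H.card * (d : ℝ) ^ 2) ^ k := h'
      _ ≤ (regularGraphs n d).card * (r * ((x - k) * M)) ^ k := by gcongr
      _ = _ := by rw [mul_pow]; ring
  exact le_of_mul_le_mul_right h3 (pow_pos hpos k)

open Classical in
/-- The number of ordered pairs of adjacent vertices in `S × A`. -/
noncomputable def adjCount {n : ℕ} (G : SimpleGraph (Fin n)) (S A : Finset (Fin n)) : ℕ :=
  ∑ v ∈ S, ((nbrs G v).filter fun w => w ∈ A).card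

/-- The unordered pairs `{a, b}` with `a ∈ S`, `b ∈ A` and `a < b`. -/
def ascPairs {n : ℕ} (S A : Finset (Fin n)) : Finset (Sym2 (Fin n)) :=
  ((S ×ˢ A).filter fun p => p.1 < p.2).image fun p => s(p.1, p.2)

theorem card_ascPairs_le {n : ℕ} (S A : Finset (Fin n)) :
    (ascPairs S A).card ≤ S.card * A.card := by
  rw [← card_product]
  exact card_image_le.trans (card_filter_le _ _)

theorem card_ascPairs_add_le {n : ℕ} (S A : Finset (Fin n)) :
    (ascPairs S A).card + (ascPairs A S).card ≤ S.card * A.card := by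
  classical
  have h2 : (ascPairs A S).card ≤ ((S ×ˢ A).filter fun p => ¬ p.1 < p.2).card := by
    refine card_image_le.trans ?_
    refine card_le_card_of_injOn Prod.swap ?_ Prod.swap_injective.injOn
    rintro ⟨a, b⟩ h
    simp only [coe_filter, mem_product, Set.mem_ofPred_eq, Prod.swap] at h ⊢
    exact ⟨h.1.symm, not_lt.2 h.2.le⟩
  have h1 : (ascPairs S A).card ≤ ((S ×ˢ A).filter fun p => p.1 < p.2).card := card_image_le
  have := card_filter_add_card_filter_not (s := S ×ˢ A) (fun p => p.1 < p.2)
  rw [card_product] at this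
  omega

open Classical in
theorem edgesIn_ascPairs {n : ℕ} (G : SimpleGraph (Fin n)) (S A : Finset (Fin n)) :
    edgesIn G (ascPairs S A)
      = (((S ×ˢ A).filter fun p : Fin n × Fin n => G.Adj p.1 p.2).filter fun p => p.1 < p.2).card := by
  rw [edgesIn, ascPairs, filter_image, card_image_of_injOn]
  · congr 1
    ext ⟨a, b⟩
    simp only [mem_filter, SimpleGraph.mem_edgeSet]
    tauto
  · rintro ⟨a, b⟩ h ⟨a', b'⟩ h' hab
    simp only [coe_filter, mem_filter, Set.mem_ofPred_eq] at h h'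
    simp only [Sym2.eq_iff] at hab
    rcases hab with ⟨rfl, rfl⟩ | ⟨rfl, rfl⟩
    · rfl
    · exact absurd h.1.2 (not_lt.2 h'.1.2.le)

/-- Tails are available for sets of unordered edges, whereas `adjCount` counts ordered pairs.
Splitting by orientation gives two families in which no edge is counted twice. -/
theorem adjCount_eq {n : ℕ} (G : SimpleGraph (Fin n)) (S A : Finset (Fin n)) :
    adjCount G S A = edgesIn G (ascPairs S A) + edgesIn G (ascPairs A S) := by
  classical
  rw [edgesIn_ascPairs, edgesIn_ascPairs]
  set P := (S ×ˢ A).filter fun p => G.Adj p.1 p.2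
  have h0 : adjCount G S A = P.card := by
    have : adjCount G S A = (S.sigma fun v => (nbrs G v).filter fun w => w ∈ A).card := by
      rw [card_sigma, adjCount]
    rw [this]
    refine card_bij' (fun q _ => (q.1, q.2)) (fun p _ => ⟨p.1, p.2⟩) ?_ ?_ ?_ ?_ <;>
      simp +contextual [P, mem_nbrs]
  have h1 : (((A ×ˢ S).filter fun p => G.Adj p.1 p.2).filter fun p => p.1 < p.2).card
      = (P.filter fun p => ¬ p.1 < p.2).card := by
    refine card_bij' (fun p _ => p.swap) (fun p _ => p.swap) ?_ ?_ ?_ ?_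
    · rintro ⟨a, b⟩ h
      simp only [mem_filter, mem_product, Prod.swap, P] at h ⊢
      exact ⟨⟨h.1.1.symm, h.1.2.symm⟩, not_lt.2 h.2.le⟩
    · rintro ⟨a, b⟩ h
      simp only [mem_filter, mem_product, Prod.swap, P] at h ⊢
      exact ⟨⟨h.1.1.symm, h.1.2.symm⟩, lt_of_le_of_ne (not_lt.1 h.2) h.1.2.ne'⟩
    · rintro ⟨a, b⟩ _; rfl
    · rintro ⟨a, b⟩ _; rfl
  rw [h0, h1, card_filter_add_card_filter_not]

/-! ### Discrepancy and sparsity of random regular graphs. -/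

/-- Pairs of vertex sets span at most `2εnd` more edges than expected. -/
def SmallDiscrepancy {n : ℕ} (d : ℕ) (ε : ℝ) (G : SimpleGraph (Fin n)) : Prop :=
  ∀ S A : Finset (Fin n),
    (adjCount G S A : ℝ) ≤ d * S.card * A.card / n + 2 * (ε * n * d)

/-- Sets of at most `cn` vertices are sparse. -/
def SmallSetsSparse {n : ℕ} (d : ℕ) (c : ℝ) (G : SimpleGraph (Fin n)) : Prop :=
  ∀ U : Finset (Fin n), (U.card : ℝ) ≤ c * n → (adjCount G U U : ℝ) ≤ d * U.card / 200

theorem card_discrepancy_pair {n d : ℕ} {ε : ℝ} (hn : 1 ≤ n) (hd : 1 ≤ d) (hε : 0 < ε)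
    (hε1 : ε ≤ 1) (h1 : 544 ≤ ε ^ 2 * d) (h2 : 64 * (d : ℝ) ≤ ε * n) (H : Finset (Sym2 (Fin n)))
    (hH : H.card ≤ n * n) :
    (((regularGraphs n d).filter fun G => d * H.card / n + ε * n * d ≤ edgesIn G H).card : ℝ)
      ≤ Real.exp (-(4 * n)) * (regularGraphs n d).card := by
  have hn' : (1 : ℝ) ≤ n := by exact_mod_cast hn
  have hd' : (1 : ℝ) ≤ d := by exact_mod_cast hd
  have hn0 : (0 : ℝ) < n := by linarith
  have hd0 : (0 : ℝ) < d := by linarith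
  have hH' : (H.card : ℝ) ≤ n * n := by exact_mod_cast hH
  have hH0 : (0 : ℝ) ≤ H.card := by positivity
  -- The moment is chosen so that `(1 - ε / 4) ^ k ≤ exp (-4n)`, which beats the `4 ^ n` pairs of
  -- sets. As `544 = 17 * 32`, `h1` gives `k ≤ εnd / 32`; with `h2` the switching loss is at most
  -- `εnd / 8`.
  set k := ⌈16 * n / ε⌉₊ with hk
  have hk1 : 16 * n / ε ≤ k := Nat.le_ceil _
  have hk2 : (k : ℝ) ≤ ε * n * d / 32 := by
    have e1 : (k : ℝ) < 16 * n / ε + 1 := Nat.ceil_lt_add_one (by positivity)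
    have e2 : 16 * n / ε + 1 ≤ 17 * n / ε := by
      rw [div_add_one hε.ne']
      gcongr
      linarith
    have e3 : 17 * n / ε ≤ ε * n * d / 32 := by
      rw [div_le_div_iff₀ hε (by norm_num)]
      nlinarith
    linarith
  have hend : 0 < ε * n * d := by positivity
  have hdd : 2 * ((d : ℝ) * (d + 1)) ≤ ε * n * d / 16 := by nlinarith
  refine (card_edgesIn_ge_real H (M := n * d * (1 - ε / 8)) (r := 1 - ε / 4) k ?_ ?_ ?_ ?_).trans ?_
  · have : 0 < 1 - ε / 8 := by linarith
    positivity
  · nlinarith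
  · have : 0 ≤ d * H.card / (n : ℝ) := by positivity
    linarith
  · have e0 : (1 - 3 * ε / 8) ≤ (1 - ε / 4) * (1 - ε / 8) := by nlinarith
    have e1 : (d : ℝ) * H.card / n + 31 / 32 * (ε * n * d) ≤ d * H.card / n + ε * n * d - k := by
      linarith
    have e2 : (H.card : ℝ) ≤ (1 - 3 * ε / 8) * (H.card + 31 / 32 * (ε * (n * n))) := by
      have e3 : 3 * ε / 8 * H.card ≤ 3 * ε / 8 * (n * n) := by gcongr
      have e4 : 5 / 8 * (31 / 32 * (ε * ((n : ℝ) * n)))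
          ≤ (1 - 3 * ε / 8) * (31 / 32 * (ε * (n * n))) := by
        gcongr
        linarith
      have e5 : 0 < ε * ((n : ℝ) * n) := by positivity
      nlinarith
    calc H.card * (d : ℝ) ^ 2
        ≤ ((1 - 3 * ε / 8) * (H.card + 31 / 32 * (ε * (n * n)))) * d ^ 2 := by gcongr
      _ ≤ (((1 - ε / 4) * (1 - ε / 8)) * (H.card + 31 / 32 * (ε * (n * n)))) * d ^ 2 := by gcongr
      _ = (1 - ε / 4) * (((d : ℝ) * H.card / n + 31 / 32 * (ε * n * d))
            * (n * d * (1 - ε / 8))) := by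
          field_simp
      _ ≤ _ := by
          have e6 : 0 ≤ 1 - ε / 8 := by linarith
          have e7 : 0 ≤ 1 - ε / 4 := by linarith
          gcongr
  · gcongr
    calc (1 - ε / 4) ^ k ≤ (Real.exp (-(ε / 4))) ^ k := by
          have e7 : 0 ≤ 1 - ε / 4 := by linarith
          gcongr
          linarith [Real.add_one_le_exp (-(ε / 4))]
      _ = Real.exp (k * -(ε / 4)) := (Real.exp_nat_mul _ _).symm
      _ ≤ _ := by
          gcongr
          have := mul_le_mul_of_nonneg_right hk1 (by positivity : 0 ≤ ε / 4)
          have e : 16 * n / ε * (ε / 4) = 4 * n := by field_simp; norm_num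
          linarith

open Classical in
theorem card_not_smallDiscrepancy {n d : ℕ} {ε : ℝ} (hn : 1 ≤ n) (hd : 1 ≤ d) (hε : 0 < ε)
    (hε1 : ε ≤ 1) (h1 : 544 ≤ ε ^ 2 * d) (h2 : 64 * (d : ℝ) ≤ ε * n) :
    (((regularGraphs n d).filter fun G => ¬ SmallDiscrepancy d ε G).card : ℝ)
      ≤ 2 / n * (regularGraphs n d).card := by
  have hn' : (1 : ℝ) ≤ n := by exact_mod_cast hn
  set R := regularGraphs n d with hR
  set bad : Finset (Sym2 (Fin n)) → Finset (SimpleGraph (Fin n)) := fun H =>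
    R.filter fun G => (d : ℝ) * H.card / n + ε * n * d ≤ edgesIn G H with hbad
  have hsub : R.filter (fun G => ¬ SmallDiscrepancy d ε G)
      ⊆ (univ : Finset (Finset (Fin n) × Finset (Fin n))).biUnion fun p =>
          bad (ascPairs p.1 p.2) ∪ bad (ascPairs p.2 p.1) := by
    intro G hG
    obtain ⟨hGR, hG⟩ := mem_filter.1 hG
    simp only [SmallDiscrepancy, not_forall, not_le] at hG
    obtain ⟨S, A, h⟩ := hG
    rw [mem_biUnion]
    refine ⟨(S, A), mem_univ _, ?_⟩
    rw [mem_union, hbad, mem_filter, mem_filter]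
    by_contra hcon
    simp only [not_or, not_and, not_le] at hcon
    have c1 := hcon.1 hGR
    have c2 := hcon.2 hGR
    rw [adjCount_eq] at h
    push_cast at h
    have c3 : ((ascPairs S A).card : ℝ) + (ascPairs A S).card ≤ S.card * A.card := by
      exact_mod_cast card_ascPairs_add_le S A
    have c4 : (d : ℝ) * (ascPairs S A).card / n + d * (ascPairs A S).card / n
        ≤ d * S.card * A.card / n := by
      rw [← add_div, ← mul_add, mul_assoc (d : ℝ)]
      gcongr
    linarith
  have hb : ∀ S A : Finset (Fin n),
      ((bad (ascPairs S A)).card : ℝ) ≤ Real.exp (-(4 * n)) * R.card := by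
    intro S A
    refine card_discrepancy_pair hn hd hε hε1 h1 h2 _ ((card_ascPairs_le S A).trans ?_)
    exact Nat.mul_le_mul ((card_le_univ S).trans_eq (Fintype.card_fin n))
      ((card_le_univ A).trans_eq (Fintype.card_fin n))
  calc ((R.filter fun G => ¬ SmallDiscrepancy d ε G).card : ℝ)
      ≤ ∑ p : Finset (Fin n) × Finset (Fin n),
          ((bad (ascPairs p.1 p.2) ∪ bad (ascPairs p.2 p.1)).card : ℝ) := by
        exact_mod_cast (card_le_card hsub).trans card_biUnion_le
    _ ≤ ∑ p : Finset (Fin n) × Finset (Fin n), 2 * (Real.exp (-(4 * n)) * R.card) := by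
        refine sum_le_sum fun p _ => ?_
        have e1 : ((bad (ascPairs p.1 p.2) ∪ bad (ascPairs p.2 p.1)).card : ℝ)
            ≤ (bad (ascPairs p.1 p.2)).card + (bad (ascPairs p.2 p.1)).card := by
          exact_mod_cast card_union_le _ _
        linarith [hb p.1 p.2, hb p.2 p.1]
    _ = 2 * ((4 : ℝ) ^ n * Real.exp (-(4 * n))) * R.card := by
        rw [sum_const, card_univ, Fintype.card_prod, Fintype.card_finset, Fintype.card_fin,
          nsmul_eq_mul]
        push_cast
        rw [← mul_pow]
        norm_num
        ring
    _ ≤ 2 / n * R.card := by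
        have e1 : (4 : ℝ) ^ n ≤ Real.exp (3 * n) := by
          rw [mul_comm, Real.exp_nat_mul]
          gcongr
          linarith [Real.add_one_le_exp (3 : ℝ)]
        have e2 : (4 : ℝ) ^ n * Real.exp (-(4 * n)) ≤ 1 / n := by
          calc (4 : ℝ) ^ n * Real.exp (-(4 * n)) ≤ Real.exp (3 * n) * Real.exp (-(4 * n)) := by gcongr
            _ = (Real.exp n)⁻¹ := by rw [← Real.exp_add, ← Real.exp_neg]; congr 1; ring
            _ ≤ 1 / n := by
                rw [one_div]
                gcongr
                linarith [Real.add_one_le_exp (n : ℝ)]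
        have e3 : 2 / (n : ℝ) = 2 * (1 / n) := by ring
        rw [e3]
        gcongr

/-- With `(n choose u) ≤ (en / u) ^ u` the product is at most `(e * 1600 ^ 3 * (u / n) ^ 2) ^ u`.
One factor `u / n ≤ 1e-11` absorbs the constants; the other yields the `1 / n`. -/
theorem choose_mul_pow_le {n u : ℕ} (hu : 1 ≤ u) (hun : (u : ℝ) ≤ 1e-11 * n) :
    (n.choose u : ℝ) * (1600 * u / n) ^ (3 * u) ≤ 1 / n * (1 / 2) ^ u := by
  have hu' : (1 : ℝ) ≤ u := by exact_mod_cast hu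
  have hn0 : (0 : ℝ) < n := by
    by_contra h
    nlinarith
  have hu0 : (0 : ℝ) < u := by linarith
  have hq : (u : ℝ) / n ≤ 1e-11 := by rwa [div_le_iff₀ hn0]
  have hq0 : 0 < (u : ℝ) / n := by positivity
  have h1 : (n.choose u : ℝ) ≤ (2.7182818286 * n / u) ^ u := by
    have e1 := Nat.choose_le_pow_div (α := ℝ) u n
    have e2 := Real.pow_div_factorial_le_exp (u : ℝ) hu0.le u
    have e3 : Real.exp (u : ℝ) ≤ 2.7182818286 ^ u := by
      rw [← mul_one (u : ℝ), Real.exp_nat_mul]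
      gcongr
      exact Real.exp_one_lt_d9.le
    calc (n.choose u : ℝ) ≤ (n : ℝ) ^ u / u.factorial := e1
      _ = (n / u : ℝ) ^ u * ((u : ℝ) ^ u / u.factorial) := by
          rw [div_pow]
          field_simp
      _ ≤ (n / u : ℝ) ^ u * 2.7182818286 ^ u := by gcongr; exact e2.trans e3
      _ = _ := by rw [← mul_pow]; congr 1; ring
  calc (n.choose u : ℝ) * (1600 * u / n) ^ (3 * u)
      ≤ (2.7182818286 * n / u) ^ u * (1600 * u / n) ^ (3 * u) := by gcongr
    _ = (2.7182818286 * 1600 ^ 3 * (u / n : ℝ) * (u / n)) ^ u := by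
        rw [pow_mul, ← mul_pow]
        congr 1
        field_simp
    _ ≤ (1 / 4 * (u / n : ℝ)) ^ u := by
        gcongr
        norm_num at hq ⊢
        linarith
    _ = (1 / 4) ^ u * (u / n : ℝ) ^ u := mul_pow _ _ _
    _ ≤ (1 / 4) ^ u * (u / n : ℝ) := by
        gcongr
        exact pow_le_of_le_one hq0.le (by norm_num at hq ⊢; linarith) (by omega)
    _ = 1 / n * ((1 / 2) ^ u * (u * (1 / 2) ^ u)) := by
        have : (1 / 4 : ℝ) ^ u = (1 / 2) ^ u * (1 / 2) ^ u := by rw [← mul_pow]; norm_num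
        rw [this]; ring
    _ ≤ 1 / n * ((1 / 2) ^ u * 1) := by
        gcongr
        rw [one_div, inv_pow, ← div_eq_mul_inv, div_le_one (by positivity)]
        exact_mod_cast Nat.lt_two_pow_self.le
    _ = _ := by rw [mul_one]

/-- The moment `3u` leaves a factor `(u / n) ^ (2u)` after the union bound over sets of size `u`.
Since `d ≥ 2400`, subtracting `3u` at most halves the threshold `du / 400`, whence the ratio `1600u
/ n`. -/
theorem card_dense_set {n d : ℕ} (hd : 2400 ≤ d) (hdn : 16 * d ≤ n) {u : ℕ} (hu : 1 ≤ u)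
    (hun : (u : ℝ) ≤ 1e-11 * n) (H : Finset (Sym2 (Fin n))) (hH : H.card ≤ u * u) :
    (((regularGraphs n d).filter fun G => (d * u / 400 : ℝ) ≤ edgesIn G H).card : ℝ)
      ≤ (1600 * u / n) ^ (3 * u) * (regularGraphs n d).card := by
  have hu' : (1 : ℝ) ≤ u := by exact_mod_cast hu
  have hd' : (2400 : ℝ) ≤ d := by exact_mod_cast hd
  have hdn' : 16 * (d : ℝ) ≤ n := by exact_mod_cast hdn
  have hH' : (H.card : ℝ) ≤ u * u := by exact_mod_cast hH
  have hn0 : (0 : ℝ) < n := by linarith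
  have hu0 : (0 : ℝ) < u := by linarith
  have hd0 : (0 : ℝ) < d := by linarith
  have hdu : 2400 * (u : ℝ) ≤ d * u := by gcongr
  norm_num at hun
  refine card_edgesIn_ge_real H (M := n * d / 2) (3 * u) (by positivity) ?_ ?_ ?_
  · push_cast
    have e1 : 2 * (3 * (u : ℝ)) ≤ n * d / 16 := by nlinarith
    have e2 : 2 * ((d : ℝ) * (d + 1)) ≤ n * d / 4 := by nlinarith
    have e3 : (0 : ℝ) < n * d := by positivity
    linarith
  · push_cast; linarith
  · push_cast
    have e1 : (H.card : ℝ) * (d : ℝ) ^ 2 ≤ (u * u) * (d : ℝ) ^ 2 := by gcongr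
    have e2 : ((u : ℝ) * u) * (d : ℝ) ^ 2
        = 1600 * (u : ℝ) / n * ((d : ℝ) * u / 800 * (n * d / 2)) := by field_simp; norm_num
    have e3 : 1600 * (u : ℝ) / n * ((d : ℝ) * u / 800 * (n * d / 2))
        ≤ 1600 * (u : ℝ) / n * (((d : ℝ) * u / 400 - 3 * u) * (n * d / 2)) := by
      gcongr
      linarith
    exact e1.trans (e2.trans_le e3)

open Classical in
theorem card_not_smallSetsSparse {n d : ℕ} (hd : 2400 ≤ d) (hdn : 16 * d ≤ n) :
    (((regularGraphs n d).filter fun G => ¬ SmallSetsSparse d 1e-11 G).card : ℝ)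
      ≤ 4 / n * (regularGraphs n d).card := by
  set R := regularGraphs n d with hR
  set bad : Finset (Fin n) → Finset (SimpleGraph (Fin n)) := fun U =>
    R.filter fun G => (d * U.card / 400 : ℝ) ≤ edgesIn G (ascPairs U U) with hbad
  -- The empty set is left out: its threshold is `0`, so `bad ∅` would be everything, although `∅`
  -- never violates sparsity.
  set small : Finset (Finset (Fin n)) := univ.filter fun U =>
    1 ≤ U.card ∧ (U.card : ℝ) ≤ 1e-11 * n with hsmall
  have hsub : R.filter (fun G => ¬ SmallSetsSparse d 1e-11 G) ⊆ small.biUnion bad := by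
    intro G hG
    obtain ⟨hGR, hG⟩ := mem_filter.1 hG
    simp only [SmallSetsSparse, not_forall, not_le] at hG
    obtain ⟨U, hU, h⟩ := hG
    rw [adjCount_eq] at h
    push_cast at h
    rw [mem_biUnion]
    refine ⟨U, mem_filter.2 ⟨mem_univ _, ?_, hU⟩, mem_filter.2 ⟨hGR, by linarith⟩⟩
    by_contra hc
    have : U = ∅ := by rw [← card_eq_zero]; omega
    subst this
    simp [edgesIn, ascPairs] at h
  -- Dividing by `n.choose u` makes the sum over all sets of size `u` a single term of a geometric
  -- series.
  set f : ℕ → ℝ := fun u => if u ≤ n then 1 / (n : ℝ) * (1 / 2) ^ u / n.choose u else 0 with hf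
  have hb : ∀ U ∈ small, ((bad U).card : ℝ) ≤ f U.card * R.card := by
    intro U hU
    obtain ⟨-, h1, h2⟩ := mem_filter.1 hU
    have hUn : U.card ≤ n := (card_le_univ U).trans_eq (Fintype.card_fin n)
    refine (card_dense_set hd hdn h1 h2 _ (card_ascPairs_le U U)).trans ?_
    gcongr
    simp only [hf, if_pos hUn]
    have hc : (0 : ℝ) < n.choose U.card := by exact_mod_cast Nat.choose_pos hUn
    rw [le_div_iff₀ hc, mul_comm]
    exact choose_mul_pow_le h1 h2
  have hf0 : ∀ u, 0 ≤ f u := by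
    intro u
    simp only [hf]
    split_ifs <;> positivity
  calc ((R.filter fun G => ¬ SmallSetsSparse d 1e-11 G).card : ℝ)
      ≤ ∑ U ∈ small, ((bad U).card : ℝ) := by
        exact_mod_cast (card_le_card hsub).trans card_biUnion_le
    _ ≤ ∑ U ∈ small, f U.card * R.card := sum_le_sum hb
    _ ≤ ∑ U ∈ (univ : Finset (Fin n)).powerset, f U.card * R.card := by
        refine sum_le_sum_of_subset_of_nonneg ?_ fun U _ _ => mul_nonneg (hf0 _) (by positivity)
        intro U _
        simp
    _ = (∑ u ∈ range (n + 1), n.choose u • f u) * R.card := by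
        rw [← sum_mul, sum_powerset_apply_card f, card_univ, Fintype.card_fin]
    _ = (∑ u ∈ range (n + 1), 1 / (n : ℝ) * (1 / 2) ^ u) * R.card := by
        congr 1
        refine sum_congr rfl fun u hu => ?_
        have hun : u ≤ n := by simpa [Nat.lt_succ_iff] using hu
        have hc : (0 : ℝ) < n.choose u := by exact_mod_cast Nat.choose_pos hun
        simp only [hf, if_pos hun, nsmul_eq_mul]
        field_simp
    _ ≤ 1 / n * 2 * R.card := by
        rw [← mul_sum]
        gcongr
        exact sum_geometric_two_le _
    _ ≤ 4 / n * R.card := by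
        gcongr
        rw [one_div, div_eq_mul_inv, mul_comm]
        gcongr
        norm_num

open Classical in
/-- A random regular graph has small discrepancy and sparse small sets with high probability. -/
theorem card_not_good {n d : ℕ} (hd : 1 ≤ d) (hn : 1 ≤ n)
    (hδ : 64 * Real.sqrt ((d : ℝ) / n + 1 / d) ≤ 1) :
    (((regularGraphs n d).filter fun G => ¬ (SmallDiscrepancy d
        (64 * Real.sqrt ((d : ℝ) / n + 1 / d)) G ∧ SmallSetsSparse d 1e-11 G)).card : ℝ)
      ≤ 6 / n * (regularGraphs n d).card := by
  have hn0 : (0 : ℝ) < n := by exact_mod_cast hn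
  have hd0 : (0 : ℝ) < d := by exact_mod_cast hd
  set q := (d : ℝ) / n + 1 / d with hq
  have hq0 : 0 < q := by positivity
  have hs0 : 0 < Real.sqrt q := Real.sqrt_pos.2 hq0
  have hsq : Real.sqrt q ^ 2 = q := Real.sq_sqrt hq0.le
  -- The assumption `64 √q ≤ 1` forces `d ≥ 4096` and `n ≥ 4096 d`; all other parameter conditions
  -- follow from `d / n ≤ q` and `1 / d ≤ q`.
  have hq1 : q ≤ 1 / 4096 := by rw [← hsq]; nlinarith
  have e1 : (d : ℝ) / n ≤ q := by rw [hq]; have : 0 < 1 / (d : ℝ) := by positivity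
                                  linarith
  have e2 : 1 / (d : ℝ) ≤ q := by rw [hq]; have : 0 < (d : ℝ) / n := by positivity
                                  linarith
  have hd' : (4096 : ℝ) ≤ d := by
    have := e2.trans hq1
    rwa [one_div_le_one_div hd0 (by norm_num)] at this
  have hdn : 4096 * (d : ℝ) ≤ n := by
    have := e1.trans hq1
    rw [div_le_iff₀ hn0] at this
    linarith
  have hdN : 2400 ≤ d := by
    have : 4096 ≤ d := by exact_mod_cast hd'
    omega
  have hdnN : 16 * d ≤ n := by
    have : 4096 * d ≤ n := by exact_mod_cast hdn
    omega
  have hD := card_not_smallDiscrepancy (d := d) hn hd (by positivity : 0 < 64 * Real.sqrt q) hδ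
    (by
      rw [mul_pow, hsq]
      rw [div_le_iff₀ hd0] at e2
      linarith)
    (by
      have h1 : (d : ℝ) / n ≤ Real.sqrt q := by
        refine e1.trans ?_
        nlinarith
      rw [div_le_iff₀ hn0] at h1
      linarith)
  have hS := card_not_smallSetsSparse hdN hdnN
  have hsub : ((regularGraphs n d).filter fun G =>
      ¬ (SmallDiscrepancy d (64 * Real.sqrt q) G ∧ SmallSetsSparse d 1e-11 G))
      ⊆ ((regularGraphs n d).filter fun G => ¬ SmallDiscrepancy d (64 * Real.sqrt q) G)
        ∪ (regularGraphs n d).filter fun G => ¬ SmallSetsSparse d 1e-11 G := by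
    intro G hG
    simp only [mem_filter, mem_union, not_and_or] at hG ⊢
    tauto
  have hc : (((regularGraphs n d).filter fun G =>
      ¬ (SmallDiscrepancy d (64 * Real.sqrt q) G ∧ SmallSetsSparse d 1e-11 G)).card : ℝ)
      ≤ ((regularGraphs n d).filter fun G => ¬ SmallDiscrepancy d (64 * Real.sqrt q) G).card
        + ((regularGraphs n d).filter fun G => ¬ SmallSetsSparse d 1e-11 G).card := by
    exact_mod_cast (card_le_card hsub).trans (card_union_le _ _)
  refine hc.trans ((add_le_add hD hS).trans_eq ?_)
  ring

/-! ### Independent uniform choices: factorisation, variance and Chebyshev's inequality. -/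

section Product

variable {V β : Type*} [Fintype V] [DecidableEq V]

theorem expect_piFinset_prod (S : V → Finset β) (g : V → β → ℝ) :
    𝔼 c ∈ Fintype.piFinset S, ∏ v, g v (c v) = ∏ v, 𝔼 b ∈ S v, g v b := by
  simp only [expect_eq_sum_div_card, prod_div_distrib]
  rw [← prod_univ_sum, Fintype.card_piFinset]
  push_cast
  rfl

theorem expect_piFinset_apply {S : V → Finset β} (hS : ∀ v, (S v).Nonempty) (v : V) (g : β → ℝ) :
    𝔼 c ∈ Fintype.piFinset S, g (c v) = 𝔼 b ∈ S v, g b := by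
  have h := expect_piFinset_prod S fun u b => if u = v then g b else 1
  simp only [prod_ite_eq', mem_univ, if_true] at h
  rw [h, prod_eq_single v]
  · simp
  · intro u _ hu
    simp only [if_neg hu]
    exact expect_const (hS u) _
  · simp

theorem expect_piFinset_mul {S : V → Finset β} (hS : ∀ v, (S v).Nonempty) {v w : V} (hvw : v ≠ w)
    (g h : β → ℝ) :
    𝔼 c ∈ Fintype.piFinset S, g (c v) * h (c w) = (𝔼 b ∈ S v, g b) * 𝔼 b ∈ S w, h b := by
  have key := expect_piFinset_prod S
    fun u b => (if u = v then g b else 1) * (if u = w then h b else 1)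
  simp only [prod_mul_distrib, prod_ite_eq', mem_univ, if_true] at key
  have h2 : ∀ u, (𝔼 b ∈ S u, (if u = v then g b else 1) * (if u = w then h b else 1))
      = (if u = v then 𝔼 b ∈ S u, g b else 1) * (if u = w then 𝔼 b ∈ S u, h b else 1) := by
    intro u
    by_cases h1 : u = v
    · have h3 : u ≠ w := h1 ▸ hvw
      simp [h1, hvw]
    · by_cases h3 : u = w
      · simp [h3, hvw.symm]
      · simp only [if_neg h1, if_neg h3, mul_one]
        exact expect_const (hS u) _
  rw [key, prod_congr rfl fun u _ => h2 u, prod_mul_distrib]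
  simp

/-- The centred terms are independent, so the cross terms vanish and each vertex contributes a
variance of at most `1`. -/
theorem expect_piFinset_sq_le {S : V → Finset β} (hS : ∀ v, (S v).Nonempty) (g : V → β → ℝ)
    (hg : ∀ v b, g v b ^ 2 ≤ 1) :
    𝔼 c ∈ Fintype.piFinset S, (∑ v, g v (c v) - ∑ v, 𝔼 b ∈ S v, g v b) ^ 2 ≤ Fintype.card V := by
  set m : V → ℝ := fun v => 𝔼 b ∈ S v, g v b with hm
  have h0 : ∀ v, 𝔼 b ∈ S v, (g v b - m v) = 0 := by
    intro v
    rw [expect_sub_distrib, expect_const (hS v), sub_self]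
  have h1 : ∀ c : V → β, (∑ v, g v (c v) - ∑ v, m v) ^ 2
      = ∑ v, ∑ w, (g v (c v) - m v) * (g w (c w) - m w) := by
    intro c
    rw [← sum_sub_distrib, sq, sum_mul_sum]
  simp only [h1]
  rw [expect_sum_comm]
  have h2 : ∀ v, 𝔼 c ∈ Fintype.piFinset S, ∑ w, (g v (c v) - m v) * (g w (c w) - m w) ≤ 1 := by
    intro v
    rw [expect_sum_comm, sum_eq_single v]
    · rw [expect_piFinset_apply hS v fun b => (g v b - m v) * (g v b - m v)]
      have e1 : ∀ b, (g v b - m v) * (g v b - m v) = g v b ^ 2 - (2 * m v) * g v b + m v ^ 2 := by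
        intro b; ring
      simp only [e1]
      rw [expect_add_distrib, expect_sub_distrib, expect_const (hS v), ← mul_expect]
      have e2 : 𝔼 b ∈ S v, g v b ^ 2 ≤ 1 := expect_le (hS v) fun b _ => hg v b
      change _ - 2 * m v * m v + _ ≤ _
      nlinarith [sq_nonneg (m v)]
    · intro w _ hw
      rw [expect_piFinset_mul hS hw.symm (fun b => g v b - m v) fun b => g w b - m w, h0, zero_mul]
    · simp
  calc _ ≤ ∑ v : V, (1 : ℝ) := sum_le_sum fun v _ => h2 v
    _ = _ := by simp

open Classical in
/-- Chebyshev's inequality for a sum of independent uniform choices. -/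
theorem expect_piFinset_chebyshev {S : V → Finset β} (hS : ∀ v, (S v).Nonempty) (g : V → β → ℝ)
    (hg : ∀ v b, g v b ^ 2 ≤ 1) {s : ℝ} (hs : 0 < s) (P : (V → β) → Prop)
    (hP : ∀ c, P c → ∑ v, g v (c v) ≤ (∑ v, 𝔼 b ∈ S v, g v b) - s) :
    𝔼 c ∈ Fintype.piFinset S, (if P c then (1 : ℝ) else 0) ≤ Fintype.card V / s ^ 2 := by
  rw [le_div_iff₀ (by positivity), expect_mul]
  refine le_trans (expect_le_expect fun c _ => ?_) (expect_piFinset_sq_le hS g hg)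
  split_ifs with h
  · have := hP c h
    nlinarith
  · rw [zero_mul]
    positivity

end Product

/-! ### Drift of the lead in one round. -/

/-- `1` for opinion `o` and `-1` for the other one. -/
noncomputable def sgn (o b : Bool) : ℝ := if b = o then 1 else -1

theorem sgn_sq (o b : Bool) : sgn o b ^ 2 = 1 := by
  unfold sgn; split_ifs <;> norm_num

theorem abs_sgn (o b : Bool) : |sgn o b| = 1 := by
  unfold sgn; split_ifs <;> norm_num

/-- In polynomial form, with `1 - sgn o a * sgn o b` twice the indicator of disagreement, the rule
averages over pairs to a function of the neighbourhood average and the vertex's own sign. -/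
theorem sgn_adopt (o a b x : Bool) :
    sgn o (if a = b then a else x)
      = (sgn o a + sgn o b) / 2 + sgn o x * (1 - sgn o a * sgn o b) / 2 := by
  cases o <;> cases a <;> cases b <;> cases x <;> norm_num [sgn]

/-- The number of votes for `o` minus the number of votes against `o`. -/
noncomputable def lead {V : Type*} [Fintype V] (o : Bool) (X : Config V) : ℝ :=
  ∑ v, sgn o (X v)

theorem lead_eq {V : Type*} [Fintype V] (o : Bool) (X : Config V) :
    lead o X = (votes X o : ℝ) - votes X (!o) := by
  have h : ∀ b : Bool, sgn o b = (if b = o then 1 else 0) - (if b = !o then 1 else 0) := by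
    intro b
    cases o <;> cases b <;> norm_num [sgn]
  simp only [lead, h, sum_sub_distrib, votes]
  simp

theorem votes_add {V : Type*} [Fintype V] (o : Bool) (X : Config V) :
    (votes X o : ℝ) + votes X (!o) = Fintype.card V := by
  have h : ∀ v, (if X v = o then (1 : ℝ) else 0) + (if X v = !o then 1 else 0) = 1 := by
    intro v
    cases o <;> cases X v <;> norm_num
  have : (votes X o : ℝ) + votes X (!o)
      = ∑ v, ((if X v = o then (1 : ℝ) else 0) + (if X v = !o then 1 else 0)) := by
    simp [sum_add_distrib, votes]
  rw [this]
  simp [h]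

theorem lead_eq' {V : Type*} [Fintype V] (o : Bool) (X : Config V) :
    lead o X = Fintype.card V - 2 * votes X (!o) := by
  rw [lead_eq, ← votes_add o X]
  ring

open Classical in
/-- The possible outcomes of the draws of one round. -/
noncomputable def draws {V : Type*} [Fintype V] (s : Sampling) (G : SimpleGraph V) :
    Finset (V → V × V) :=
  Fintype.piFinset (samples s G)

theorem draws_nonempty {V : Type*} [Fintype V] (s : Sampling) (G : SimpleGraph V) :
    (draws s G).Nonempty :=
  piSamples_nonempty s G

/-- The average opinion of the neighbours of `v`. -/
noncomputable def nbrAvg {V : Type*} [Fintype V] (o : Bool) (G : SimpleGraph V) (d : ℕ)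
    (X : Config V) (v : V) : ℝ :=
  (∑ w ∈ nbrs G v, sgn o (X w)) / d

/-- The expected opinion of `v` after one round. -/
noncomputable def meanSgn {V : Type*} [Fintype V] (o : Bool) (s : Sampling) (G : SimpleGraph V)
    (X : Config V) (v : V) : ℝ :=
  𝔼 p ∈ samples s G v, sgn o (if X p.1 = X p.2 then X p.1 else X v)

/-- Here `κ` is `0` with replacement and `1 / (d - 1)` without: dropping the diagonal pairs, which
always agree, multiplies the chance of disagreement by `d / (d - 1) = 1 + κ`. Later arguments use
only `0 ≤ κ ≤ 1`. -/
theorem meanSgn_eq {V : Type*} [Fintype V] {G : SimpleGraph V} {d : ℕ} (s : Sampling)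
    (hd : 2 ≤ d) :
    ∃ κ : ℝ, 0 ≤ κ ∧ κ ≤ 1 ∧ ∀ (o : Bool) (X : Config V) (v : V), (nbrs G v).card = d →
      meanSgn o s G X v
        = nbrAvg o G d X v + sgn o (X v) * ((1 + κ) * (1 - nbrAvg o G d X v ^ 2)) / 2 := by
  classical
  have hd' : (2 : ℝ) ≤ d := by exact_mod_cast hd
  have hd0 : (0 : ℝ) < d := by linarith
  have hd1 : (0 : ℝ) < d - 1 := by linarith
  have hq : ∀ (o : Bool) (X : Config V) (v : V),
      ∑ w ∈ nbrs G v, sgn o (X w) = d * nbrAvg o G d X v := by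
    intro o X v
    rw [nbrAvg]
    field_simp
  have hprod : ∀ (o : Bool) (X : Config V) (v : V), (nbrs G v).card = d →
      ∑ p ∈ nbrs G v ×ˢ nbrs G v, sgn o (if X p.1 = X p.2 then X p.1 else X v)
        = (d : ℝ) ^ 2 * (nbrAvg o G d X v + sgn o (X v) * (1 - nbrAvg o G d X v ^ 2) / 2) := by
    intro o X v hv
    simp only [sgn_adopt]
    rw [sum_product]
    simp only [sum_add_distrib, ← sum_div, ← mul_sum, sum_sub_distrib, ← sum_mul, sum_const, hv,
      nsmul_eq_mul]
    simp only [hq]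
    ring
  cases s with
  | withReplacement =>
    refine ⟨0, le_rfl, zero_le_one, fun o X v hv => ?_⟩
    have hne : (nbrs G v ×ˢ nbrs G v).Nonempty := by
      rw [← card_pos, card_product, hv]; positivity
    have hs : samples .withReplacement G v = nbrs G v ×ˢ nbrs G v := if_pos hne
    rw [meanSgn, expect_eq_sum_div_card, hs, hprod o X v hv, card_product, hv]
    push_cast
    field_simp
    ring
  | withoutReplacement =>
    refine ⟨1 / (d - 1), by positivity, ?_, fun o X v hv => ?_⟩
    · rw [div_le_one hd1]; linarith
    have hcard : (nbrs G v).offDiag.card = d * d - d := by rw [offDiag_card, hv]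
    have hne : (nbrs G v).offDiag.Nonempty := by
      rw [← card_pos, hcard]
      have : d * 2 ≤ d * d := Nat.mul_le_mul_left _ hd
      omega
    have hs : samples .withoutReplacement G v = (nbrs G v).offDiag := if_pos hne
    have hcard' : (((nbrs G v).offDiag.card : ℕ) : ℝ) = d * (d - 1) := by
      rw [hcard, Nat.cast_sub (Nat.le_mul_self d)]
      push_cast
      ring
    have hsum : ∑ p ∈ (nbrs G v).offDiag, sgn o (if X p.1 = X p.2 then X p.1 else X v)
        = ∑ p ∈ nbrs G v ×ˢ nbrs G v, sgn o (if X p.1 = X p.2 then X p.1 else X v)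
          - d * nbrAvg o G d X v := by
      rw [← diag_union_offDiag, sum_union (disjoint_diag_offDiag _), sum_diag]
      simp only [if_true, hq]
      ring
    rw [meanSgn, expect_eq_sum_div_card, hs, hsum, hprod o X v hv, hcard']
    field_simp
    ring

theorem sum_meanSgn {V : Type*} [Fintype V] (o : Bool) (s : Sampling) (G : SimpleGraph V)
    (X : Config V) :
    𝔼 c ∈ draws s G, lead o (update X c) = ∑ v, meanSgn o s G X v := by
  classical
  unfold lead update draws
  rw [expect_sum_comm]
  refine sum_congr rfl fun v _ => ?_
  exact expect_piFinset_apply (samples_nonempty s G) v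
    fun p => sgn o (if X p.1 = X p.2 then X p.1 else X v)

open Classical in
theorem lead_chebyshev {V : Type*} [Fintype V] (o : Bool) (s : Sampling) (G : SimpleGraph V)
    (X : Config V) {r : ℝ} (hr : 0 < r) (P : Config V → Prop)
    (hP : ∀ Y, P Y → lead o Y ≤ (∑ v, meanSgn o s G X v) - r) :
    𝔼 c ∈ draws s G, (if P (update X c) then (1 : ℝ) else 0) ≤ Fintype.card V / r ^ 2 :=
  expect_piFinset_chebyshev (samples_nonempty s G)
    (fun v p => sgn o (if X p.1 = X p.2 then X p.1 else X v)) (fun _ _ => (sgn_sq _ _).le) hr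
    (fun c => P (update X c)) fun _ hc => hP _ hc

section Regular

variable {n d : ℕ} {G : SimpleGraph (Fin n)}

theorem sum_sum_nbrs (hG : ∀ v, (nbrs G v).card = d) (f : Fin n → ℝ) :
    ∑ v, ∑ w ∈ nbrs G v, f w = d * ∑ v, f v := by
  classical
  have h : ∀ v, ∑ w ∈ nbrs G v, f w = ∑ w, if G.Adj v w then f w else 0 := by
    intro v
    rw [nbrs, sum_filter]
  simp only [h]
  rw [sum_comm, mul_sum]
  refine sum_congr rfl fun w _ => ?_
  rw [← sum_filter, sum_const, nsmul_eq_mul, ← hG w]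
  congr 3
  ext v
  simp [mem_nbrs, G.adj_comm]

theorem abs_nbrAvg_le (hG : ∀ v, (nbrs G v).card = d) (o : Bool) (X : Config (Fin n))
    (v : Fin n) : |nbrAvg o G d X v| ≤ 1 := by
  rw [nbrAvg, abs_div, Nat.abs_cast]
  refine div_le_one_of_le₀ ?_ (by positivity)
  refine (abs_sum_le_sum_abs _ _).trans ?_
  simp [abs_sgn, hG]

theorem abs_lead_le (o : Bool) (X : Config (Fin n)) : |lead o X| ≤ n := by
  refine (abs_sum_le_sum_abs _ _).trans ?_
  simp [abs_sgn]

theorem sum_nbrAvg (hG : ∀ v, (nbrs G v).card = d) (hd : 1 ≤ d) (o : Bool)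
    (X : Config (Fin n)) : ∑ v, nbrAvg o G d X v = lead o X := by
  have hd0 : (d : ℝ) ≠ 0 := by positivity
  simp only [nbrAvg]
  rw [← sum_div, sum_sum_nbrs hG fun w => sgn o (X w), lead]
  field_simp

theorem sum_nbrAvg_eq_adjCount (hG : ∀ v, (nbrs G v).card = d) (hd : 1 ≤ d) (o : Bool)
    (X : Config (Fin n)) (S : Finset (Fin n)) :
    ∑ v ∈ S, nbrAvg o G d X v = 2 * adjCount G S (univ.filter fun v => X v = o) / d - S.card := by
  classical
  have hd0 : (d : ℝ) ≠ 0 := by positivity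
  have h : ∀ v, nbrAvg o G d X v
      = (2 * (((nbrs G v).filter fun w => w ∈ univ.filter fun v => X v = o).card : ℝ)) / d - 1 := by
    intro v
    have h1 : ∀ w, sgn o (X w) = 2 * (if X w = o then 1 else 0) - 1 := by
      intro w; unfold sgn; split_ifs <;> norm_num
    rw [nbrAvg]
    simp only [h1, sum_sub_distrib, ← mul_sum, sum_const, hG v, mem_filter, mem_univ, true_and]
    rw [sum_boole, nsmul_eq_mul, mul_one, sub_div, div_self hd0]
  simp only [h, sum_sub_distrib, adjCount]
  rw [← sum_div, ← mul_sum]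
  push_cast
  simp only [sum_const, nsmul_eq_mul, mul_one]

/-- The deviations sum to zero, so their absolute sum is twice the sum over the set `S` where they
are nonnegative. A one-sided discrepancy bound for `S` and the holders of `o` therefore suffices. -/
theorem sum_abs_nbrAvg_sub_le (hG : ∀ v, (nbrs G v).card = d) (hd : 1 ≤ d) (hn : 1 ≤ n) {ε : ℝ}
    (hdisc : SmallDiscrepancy d ε G) (o : Bool) (X : Config (Fin n)) :
    ∑ v, |nbrAvg o G d X v - lead o X / n| ≤ 8 * ε * n := by
  classical
  have hd0 : (0 : ℝ) < d := by exact_mod_cast hd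
  have hn0 : (0 : ℝ) < n := by exact_mod_cast hn
  set z : Fin n → ℝ := fun v => nbrAvg o G d X v - lead o X / n with hz
  set S : Finset (Fin n) := univ.filter fun v => 0 ≤ z v with hS
  have h0 : ∑ v, z v = 0 := by
    simp only [hz]
    rw [sum_sub_distrib, sum_nbrAvg hG hd, sum_const, card_univ, Fintype.card_fin, nsmul_eq_mul]
    field_simp
    ring
  have h1 : ∑ v, |z v| = 2 * ∑ v ∈ S, z v := by
    have : ∀ v, |z v| = 2 * (if 0 ≤ z v then z v else 0) - z v := by
      intro v
      split_ifs with h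
      · rw [abs_of_nonneg h]; ring
      · rw [abs_of_neg (not_le.1 h)]; ring
    rw [sum_congr rfl fun v _ => this v, sum_sub_distrib, h0, ← mul_sum, hS, sum_filter, sub_zero]
  have h2 : ∑ v ∈ S, z v = 2 * (adjCount G S (univ.filter fun v => X v = o) / d
      - S.card * votes X o / n) := by
    have e : lead o X = 2 * votes X o - n := by
      have e1 := votes_add o X
      rw [Fintype.card_fin] at e1
      rw [lead_eq]
      linarith
    simp only [hz]
    rw [sum_sub_distrib, sum_nbrAvg_eq_adjCount hG hd, sum_const, nsmul_eq_mul, e]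
    field_simp
    ring
  have h3 := hdisc S (univ.filter fun v => X v = o)
  have h4 : (adjCount G S (univ.filter fun v => X v = o) : ℝ) / d
      ≤ S.card * votes X o / n + 2 * ε * n := by
    rw [div_le_iff₀ hd0]
    refine h3.trans (le_of_eq ?_)
    rw [votes]
    ring
  rw [h1, h2]
  linarith

theorem le_sum_meanSgn_of_discrepancy (hG : ∀ v, (nbrs G v).card = d) (hd : 2 ≤ d) (hn : 1 ≤ n)
    {ε c : ℝ} (hdisc : SmallDiscrepancy d ε G) (s : Sampling) (o : Bool) (X : Config (Fin n))
    (hε : 16 * ε * n ≤ c * lead o X) (hlead : 0 ≤ lead o X)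
    (hc : 0 ≤ c) (hlead' : lead o X ≤ (1 - 2 * c) * n) :
    (1 + c / 2) * lead o X ≤ ∑ v, meanSgn o s G X v := by
  have hn0 : (0 : ℝ) < n := by exact_mod_cast hn
  obtain ⟨κ, hκ0, -, hκ⟩ := meanSgn_eq (G := G) s hd
  set ν := lead o X / n with hν
  have hνD : lead o X = ν * n := by rw [hν]; field_simp
  have hν0 : 0 ≤ ν := by positivity
  have hν1 : ν ≤ 1 - 2 * c := by rw [hν, div_le_iff₀ hn0]; exact hlead'
  set q := nbrAvg o G d X with hq
  -- As `|q v ^ 2 - ν ^ 2| ≤ 2 |q v - ν|`, replacing `q v` by `ν` costs at most `16εn ≤ c * lead`,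
  -- half of the main term `lead * (1 - ν ^ 2) ≥ 2c * lead`.
  have hW : c * lead o X ≤ ∑ v, sgn o (X v) * (1 - q v ^ 2) := by
    have h1 : ∀ v, sgn o (X v) * (1 - ν ^ 2) - 2 * |q v - ν| ≤ sgn o (X v) * (1 - q v ^ 2) := by
      intro v
      have e1 : |sgn o (X v) * ((q v - ν) * (q v + ν))| ≤ 2 * |q v - ν| := by
        rw [abs_mul, abs_mul, abs_sgn, one_mul, mul_comm]
        gcongr
        have := abs_nbrAvg_le hG o X v
        refine (abs_add_le _ _).trans ?_
        rw [abs_of_nonneg hν0]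
        linarith
      have e2 := (abs_le.1 e1).2
      nlinarith
    have h2 := sum_le_sum fun v (_ : v ∈ univ) => h1 v
    rw [sum_sub_distrib, ← sum_mul, ← mul_sum] at h2
    have h3 := sum_abs_nbrAvg_sub_le hG (by omega) hn hdisc o X
    change lead o X * (1 - ν ^ 2) - 2 * ∑ v, |q v - ν| ≤ _ at h2
    change ∑ v, |q v - ν| ≤ _ at h3
    have h4 : 2 * c ≤ 1 - ν ^ 2 := by nlinarith
    have h5 : lead o X * (2 * c) ≤ lead o X * (1 - ν ^ 2) := by gcongr
    linarith
  have hsum : ∑ v, meanSgn o s G X v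
      = lead o X + (1 + κ) / 2 * ∑ v, sgn o (X v) * (1 - q v ^ 2) := by
    rw [sum_congr rfl fun v _ => hκ o X v (hG v), sum_add_distrib, sum_nbrAvg hG (by omega), mul_sum]
    congr 1
    refine sum_congr rfl fun v _ => ?_
    ring
  rw [hsum]
  have : 0 ≤ c * lead o X := by positivity
  nlinarith

/-- Let `p v` be the fraction of minority neighbours, so `∑ p v = b`. By Markov's inequality at most
`16b` vertices have `p v > 1 / 16`; with the minority they form a set `U` of size at most `17b`, and
sparsity gives `∑ p v ≤ 17b / 200` over `U`. A vertex outside `U` joins the minority with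
probability at most `p v ^ 2 ≤ p v / 16`. The expected new minority is at most `b / 16 + 3 * 17b /
200 < b / 2` when `b > 0`. -/
theorem le_sum_meanSgn_of_sparse (hG : ∀ v, (nbrs G v).card = d) (hd : 2 ≤ d)
    {c : ℝ} (hsparse : SmallSetsSparse d c G) (s : Sampling) (o : Bool) (X : Config (Fin n))
    (hB : 17 * (votes X (!o) : ℝ) ≤ c * n) :
    (n : ℝ) - votes X (!o) ≤ ∑ v, meanSgn o s G X v := by
  classical
  have hd0 : (0 : ℝ) < d := by positivity
  obtain ⟨κ, hκ0, hκ1, hκ⟩ := meanSgn_eq (G := G) s hd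
  set b : ℝ := ((votes X (!o) : ℕ) : ℝ) with hb
  set B : Finset (Fin n) := univ.filter fun v => X v = !o with hBdef
  have hBc : (B.card : ℝ) = b := rfl
  set p : Fin n → ℝ := fun v => (1 - nbrAvg o G d X v) / 2 with hp
  have hq : ∀ v, nbrAvg o G d X v = 1 - 2 * p v := fun v => by simp only [hp]; ring
  have hp0 : ∀ v, 0 ≤ p v := fun v => by
    have := (abs_le.1 (abs_nbrAvg_le hG o X v)).2
    simp only [hp]; linarith
  have hp1 : ∀ v, p v ≤ 1 := fun v => by
    have := (abs_le.1 (abs_nbrAvg_le hG o X v)).1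
    simp only [hp]; linarith
  have hpsum : ∑ v, p v = b := by
    have h1 := sum_nbrAvg hG (by omega) o X
    simp only [hq, sum_sub_distrib, ← mul_sum] at h1
    rw [lead_eq'] at h1
    simp at h1
    linarith
  set T : Finset (Fin n) := univ.filter fun v => 1 / 16 < p v with hT
  have hTc : (T.card : ℝ) ≤ 16 * b := by
    have h1 : (T.card : ℝ) * (1 / 16) ≤ ∑ v ∈ T, p v := by
      rw [← nsmul_eq_mul]
      exact card_nsmul_le_sum _ _ _ fun v hv => (mem_filter.1 hv).2.le
    have h2 : ∑ v ∈ T, p v ≤ ∑ v, p v :=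
      sum_le_sum_of_subset_of_nonneg (subset_univ _) fun v _ _ => hp0 v
    linarith
  set U := B ∪ T with hU
  have hUc : (U.card : ℝ) ≤ 17 * b := by
    have : (U.card : ℝ) ≤ B.card + T.card := by exact_mod_cast card_union_le _ _
    linarith
  have hUsum : ∑ v ∈ U, p v ≤ 17 * b / 200 := by
    have h1 : ∑ v ∈ U, p v = adjCount G U B / d := by
      have e1 := sum_nbrAvg_eq_adjCount hG (by omega) (!o) X U
      have e2 : ∀ v, nbrAvg (!o) G d X v = 2 * p v - 1 := by
        intro v
        have e3 : ∀ w, sgn (!o) (X w) = - sgn o (X w) := by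
          intro w
          cases o <;> cases X w <;> norm_num [sgn]
        simp only [hp, nbrAvg, e3, sum_neg_distrib]
        ring
      simp only [e2, sum_sub_distrib, ← mul_sum, sum_const, nsmul_eq_mul, mul_one] at e1
      rw [← hBdef, mul_div_assoc] at e1
      linarith
    have h2 : (adjCount G U B : ℝ) ≤ adjCount G U U := by
      have : adjCount G U B ≤ adjCount G U U := by
        refine sum_le_sum fun v _ => card_le_card fun w hw => ?_
        rw [mem_filter] at hw ⊢
        exact ⟨hw.1, mem_union_left _ hw.2⟩
      exact_mod_cast this
    have h3 := hsparse U (hUc.trans hB)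
    rw [h1, div_le_iff₀ hd0]
    have h4 : (d : ℝ) * U.card ≤ d * (17 * b) := by gcongr
    linarith
  -- For a majority vertex the left side is `p ^ 2 - κp(1 - p)`; for a minority vertex it is `p + (1
  -- + κ)p(1 - p) ≤ 3p`.
  have hstep : ∀ v, (1 - meanSgn o s G X v) / 2 ≤ p v / 16 + if v ∈ U then 3 * p v else 0 := by
    intro v
    rw [hκ o X v (hG v), hq]
    have h0 := hp0 v
    have h1 := hp1 v
    have hpp : 0 ≤ p v * (1 - p v) := mul_nonneg h0 (by linarith)
    have hκp : 0 ≤ κ * (p v * (1 - p v)) := mul_nonneg hκ0 hpp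
    have hκp' : κ * (p v * (1 - p v)) ≤ p v * (1 - p v) := mul_le_of_le_one_left hpp hκ1
    by_cases hv : v ∈ U
    · rw [if_pos hv]
      rcases abs_eq (zero_le_one' ℝ) |>.1 (abs_sgn o (X v)) with h | h <;> rw [h] <;> nlinarith
    · rw [if_neg hv]
      have hvB : ¬ X v = !o := fun h => hv (mem_union_left _ (mem_filter.2 ⟨mem_univ _, h⟩))
      have hvT : p v ≤ 1 / 16 := by
        by_contra h
        exact hv (mem_union_right _ (mem_filter.2 ⟨mem_univ _, not_le.1 h⟩))
      have hs : sgn o (X v) = 1 := by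
        rw [sgn, if_pos]
        revert hvB
        cases o <;> cases X v <;> simp
      rw [hs]
      have : p v * p v ≤ p v * (1 / 16) := by gcongr
      nlinarith
  have htot := sum_le_sum fun v (_ : v ∈ univ) => hstep v
  rw [sum_add_distrib, ← sum_div, ← sum_div, sum_sub_distrib, hpsum, ← sum_filter,
    ← mul_sum] at htot
  have hfil : (univ.filter fun v => v ∈ U) = U := by ext; simp
  rw [hfil] at htot
  simp only [sum_const, card_univ, Fintype.card_fin, nsmul_eq_mul, mul_one] at htot
  have hb0 : 0 ≤ b := by positivity
  linarith

end Regular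

/-! ### Potentials along the voting process against the adversary. -/

theorem tsum_bind_mul {α β : Type*} (p : PMF α) (f : α → PMF β) (g : β → ℝ≥0∞) :
    ∑' b, (p.bind f) b * g b = ∑' a, p a * ∑' b, f a b * g b := by
  simp only [PMF.bind_apply, ← ENNReal.tsum_mul_right, ← ENNReal.tsum_mul_left]
  rw [ENNReal.tsum_comm]
  simp only [mul_assoc]

theorem tsum_pure_mul {α : Type*} (a : α) (g : α → ℝ≥0∞) :
    ∑' b, (PMF.pure a) b * g b = g a := by
  rw [tsum_eq_single a]
  · simp
  · intro b hb
    simp [hb]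

theorem tsum_map_mul {α β : Type*} (p : PMF α) (f : α → β) (g : β → ℝ≥0∞) :
    ∑' b, (p.map f) b * g b = ∑' a, p a * g (f a) := by
  rw [PMF.map, tsum_bind_mul]
  simp only [Function.comp_apply, tsum_pure_mul]

theorem tsum_roundLaw_mul {V : Type*} [Fintype V] (s : Sampling) (G : SimpleGraph V)
    (f : (V → V × V) → ℝ) (hf : ∀ c, 0 ≤ f c) :
    ∑' c, roundLaw s G c * ENNReal.ofReal (f c) = ENNReal.ofReal (𝔼 c ∈ draws s G, f c) := by
  classical
  have h : ∀ c, roundLaw s G c * ENNReal.ofReal (f c)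
      = if c ∈ draws s G then ((draws s G).card : ℝ≥0∞)⁻¹ * ENNReal.ofReal (f c) else 0 := by
    intro c
    rw [roundLaw, PMF.uniformOfFinset_apply, draws]
    split_ifs <;> simp
  have hc : 0 < (draws s G).card := card_pos.2 (draws_nonempty s G)
  simp only [h]
  rw [tsum_eq_sum (s := draws s G) fun c hc => if_neg hc, sum_congr rfl fun c hc => if_pos hc,
    ← mul_sum, ← ENNReal.ofReal_sum_of_nonneg fun c _ => hf c, expect_eq_sum_div_card,
    ENNReal.ofReal_div_of_pos (by exact_mod_cast hc), ENNReal.ofReal_natCast, mul_comm,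
    div_eq_mul_inv]

/-- The expectation of a function of the configuration after `t` steps. -/
noncomputable def expectAt {V : Type*} [Fintype V] (s : Sampling) (G : SimpleGraph V)
    (adv : Adversary V) (X₀ : Config V) (t : ℕ) (f : Config V → ℝ) : ℝ≥0∞ :=
  ∑' p, votingLaw s G adv X₀ t p * ENNReal.ofReal (f p.2)

section Voting

variable {V : Type*} [Fintype V] {s : Sampling} {G : SimpleGraph V} {adv : Adversary V}
  {X₀ : Config V}

theorem expectAt_zero (f : Config V → ℝ) :
    expectAt s G adv X₀ 0 f = ENNReal.ofReal (f X₀) :=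
  tsum_pure_mul _ fun p : List (V → V × V) × Config V => ENNReal.ofReal (f p.2)

theorem expectAt_mono {f g : Config V → ℝ} (h : ∀ X, f X ≤ g X) (t : ℕ) :
    expectAt s G adv X₀ t f ≤ expectAt s G adv X₀ t g :=
  ENNReal.tsum_le_tsum fun p => mul_le_mul_right (ENNReal.ofReal_le_ofReal (h p.2)) _

/-- The adversary is neutralised here: `g` depends only on vote counts, so it takes the same value
before and after the rearrangement, while `hstep` covers every configuration. -/
theorem expectAt_succ_le {f g : Config V → ℝ} (hf : ∀ X, 0 ≤ f X)
    (hinv : ∀ X Y, (∀ o, votes X o = votes Y o) → g X = g Y)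
    (hstep : ∀ X, 𝔼 c ∈ draws s G, f (update X c) ≤ g X) (t : ℕ) :
    expectAt s G adv X₀ (t + 1) f ≤ expectAt s G adv X₀ t g := by
  rw [expectAt, votingLaw, tsum_bind_mul]
  refine ENNReal.tsum_le_tsum fun p => mul_le_mul_right ?_ _
  rw [tsum_map_mul, tsum_roundLaw_mul s G _ fun c => hf _]
  refine ENNReal.ofReal_le_ofReal ((hstep _).trans_eq ?_)
  exact hinv _ _ fun o => adv.votes_rearrange _ _ _

/-- The index `j` counts the remaining steps: `φ j` bounds the failure probability `j` steps before
the end, and the expectation is pulled backwards in time. -/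
theorem expectAt_add_le {φ : ℕ → Config V → ℝ} (hφ : ∀ j X, 0 ≤ φ j X)
    (hinv : ∀ j X Y, (∀ o, votes X o = votes Y o) → φ j X = φ j Y)
    (hstep : ∀ j X, 𝔼 c ∈ draws s G, φ j (update X c) ≤ φ (j + 1) X) (t k : ℕ) :
    expectAt s G adv X₀ (t + k) (φ 0) ≤ expectAt s G adv X₀ t (φ k) := by
  suffices h : ∀ j, expectAt s G adv X₀ (t + k) (φ j) ≤ expectAt s G adv X₀ t (φ (j + k)) by
    simpa using h 0
  induction k with
  | zero => intro j; exact le_rfl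
  | succ k ih =>
    intro j
    refine (expectAt_succ_le (hφ j) (hinv (j + 1)) (hstep j) (t + k)).trans ?_
    rw [show j + (k + 1) = j + 1 + k by ring]
    exact ih (j + 1)

/-- `0` if all vertices hold opinion `o`, and `1` otherwise. -/
noncomputable def failure (o : Bool) (X : Config V) : ℝ := if votes X (!o) = 0 then 0 else 1

theorem votes_not_eq_zero {o : Bool} {X : Config V} : votes X (!o) = 0 ↔ ∀ v, X v = o := by
  rw [votes, card_eq_zero, filter_eq_empty_iff]
  refine ⟨fun h v => ?_, fun h v _ => ?_⟩
  · have := h (mem_univ v)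
    revert this
    cases o <;> cases X v <;> simp
  · rw [h v]
    cases o <;> simp

theorem expect_failure_le (o : Bool) (X : Config V) :
    𝔼 c ∈ draws s G, failure o (update X c) ≤ failure o X := by
  refine expect_le (draws_nonempty s G) fun c _ => ?_
  by_cases h : votes X (!o) = 0
  · have h' := votes_not_eq_zero.1 h
    have : votes (update X c) (!o) = 0 := votes_not_eq_zero.2 fun v => by simp [update, h']
    rw [failure, failure, if_pos h, if_pos this]
  · rw [failure, failure, if_neg h]
    split_ifs <;> norm_num

theorem prob_unanimous_ge {o : Bool} {t : ℕ} {δ : ℝ} (hδ : 0 ≤ δ)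
    (h : expectAt s G adv X₀ t (failure o) ≤ ENNReal.ofReal δ) :
    1 - δ ≤ prob (votingLaw s G adv X₀ t) {p | ∀ v, p.2 v = o} := by
  classical
  set μ := votingLaw s G adv X₀ t with hμ
  set E : Set (List (V → V × V) × Config V) := {p | ∀ v, p.2 v = o} with hE
  have h1 : μ.toOuterMeasure E + expectAt s G adv X₀ t (failure o) = 1 := by
    rw [PMF.toOuterMeasure_apply, expectAt, ← ENNReal.tsum_add, ← PMF.tsum_coe μ]
    refine tsum_congr fun p => ?_
    by_cases hp : p ∈ E
    · have : votes p.2 (!o) = 0 := votes_not_eq_zero.2 hp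
      rw [Set.indicator_of_mem hp, failure, if_pos this]
      simp
    · have : ¬ votes p.2 (!o) = 0 := fun h => hp (votes_not_eq_zero.1 h)
      rw [Set.indicator_of_notMem hp, failure, if_neg this]
      simp [hμ]
  have h2 : (1 : ℝ≥0∞) ≤ μ.toOuterMeasure E + ENNReal.ofReal δ := by
    rw [← h1]
    gcongr
  have hfin : μ.toOuterMeasure E ≠ ∞ := by
    refine ne_top_of_le_ne_top ENNReal.one_ne_top ?_
    rw [← h1]
    exact le_self_add
  have h3 := ENNReal.toReal_mono (ENNReal.add_ne_top.2 ⟨hfin, ENNReal.ofReal_ne_top⟩) h2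
  rw [ENNReal.toReal_add hfin ENNReal.ofReal_ne_top, ENNReal.toReal_ofReal hδ,
    ENNReal.toReal_one] at h3
  rw [prob]
  linarith

/-- The two kinds of progress that a voting round makes with high probability: a lead of at least
`θn` grows by the factor `1 + γ` until the minority has at most `cn` votes, and then the minority
stays that small and halves in expectation. -/
structure RoundProgress (s : Sampling) (G : SimpleGraph V) (o : Bool) (c γ θ η : ℝ) : Prop where
  grow : ∀ X : Config V, θ * Fintype.card V ≤ lead o X → c * Fintype.card V < votes X (!o) →
    𝔼 d ∈ draws s G, (if lead o (update X d) < (1 + γ) * lead o X then (1 : ℝ) else 0) ≤ η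
  halve : ∀ X : Config V, (votes X (!o) : ℝ) ≤ c * Fintype.card V →
    𝔼 d ∈ draws s G, (votes (update X d) (!o) : ℝ) ≤ votes X (!o) / 2
  stay : ∀ X : Config V, (votes X (!o) : ℝ) ≤ c * Fintype.card V →
    𝔼 d ∈ draws s G, (if c * Fintype.card V < votes (update X d) (!o) then (1 : ℝ) else 0) ≤ η

/-- A bound for the probability that a minority of at most `cn` votes survives `j` more steps. -/
noncomputable def latePotential (o : Bool) (c η : ℝ) (j : ℕ) (X : Config V) : ℝ :=
  if (votes X (!o) : ℝ) ≤ c * Fintype.card V then min 1 ((1 / 2) ^ j * votes X (!o) + j * η) else 1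

/-- A bound for the probability of failure while the lead still has to grow for `i` steps. -/
noncomputable def earlyPotential (o : Bool) (c γ θ η A : ℝ) (i : ℕ) (X : Config V) : ℝ :=
  if max ((1 - 2 * c) * (1 + γ)⁻¹ ^ i) θ * Fintype.card V ≤ lead o X then min 1 (A + i * η) else 1

theorem lead_le_iff {o : Bool} {X : Config V} {c : ℝ} :
    (1 - 2 * c) * Fintype.card V ≤ lead o X ↔ (votes X (!o) : ℝ) ≤ c * Fintype.card V := by
  rw [lead_eq']
  constructor <;> intro h <;> linarith

/-- Halving controls the linear part; leaving the region of small minority, where the potential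
jumps to `1`, costs at most `η`. -/
theorem expect_latePotential_le {o : Bool} {c γ θ η : ℝ} (hη : 0 ≤ η)
    (h : RoundProgress s G o c γ θ η) (j : ℕ) (X : Config V) :
    𝔼 d ∈ draws s G, latePotential o c η j (update X d) ≤ latePotential o c η (j + 1) X := by
  have hne := draws_nonempty s G
  have h1 : ∀ Y : Config V, latePotential o c η j Y ≤ 1 := by
    intro Y; unfold latePotential; split_ifs
    · exact min_le_left _ _
    · exact le_rfl
  have hle1 : 𝔼 d ∈ draws s G, latePotential o c η j (update X d) ≤ 1 :=
    expect_le hne fun d _ => h1 _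
  rw [latePotential.eq_def o c η (j + 1)]
  split_ifs with hX
  · refine le_min hle1 ?_
    have h2 : ∀ Y : Config V, latePotential o c η j Y ≤ (1 / 2) ^ j * votes Y (!o) + j * η
        + if c * Fintype.card V < votes Y (!o) then (1 : ℝ) else 0 := by
      intro Y
      unfold latePotential
      by_cases hY : (votes Y (!o) : ℝ) ≤ c * Fintype.card V
      · rw [if_pos hY, if_neg (not_lt.2 hY), add_zero]
        exact min_le_right _ _
      · rw [if_neg hY, if_pos (not_le.1 hY)]
        have : 0 ≤ (1 / 2 : ℝ) ^ j * votes Y (!o) + j * η := by positivity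
        linarith
    refine (expect_le_expect fun d _ => h2 (update X d)).trans ?_
    rw [expect_add_distrib, expect_add_distrib, ← mul_expect, expect_const hne]
    have e1 := mul_le_mul_of_nonneg_left (h.halve X hX) (by positivity : 0 ≤ (1 / 2 : ℝ) ^ j)
    have e2 := h.stay X hX
    rw [pow_succ]
    push_cast
    linarith
  · exact hle1

theorem expect_earlyPotential_le {o : Bool} {c γ θ η A : ℝ} (hc : 2 * c ≤ 1) (hγ : 0 ≤ γ)
    (hθ : 0 ≤ θ) (hθ' : θ ≤ 1 - 2 * c) (hη : 0 ≤ η) (hA : 0 ≤ A)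
    (h : RoundProgress s G o c γ θ η) (i : ℕ) (X : Config V) :
    𝔼 d ∈ draws s G, earlyPotential o c γ θ η A i (update X d)
      ≤ earlyPotential o c γ θ η A (i + 1) X := by
  have hne := draws_nonempty s G
  set N : ℝ := (Fintype.card V : ℝ) with hN
  have hN0 : 0 ≤ N := by positivity
  have hγ1 : (0 : ℝ) < 1 + γ := by linarith
  have h1 : ∀ Y : Config V, earlyPotential o c γ θ η A i Y ≤ 1 := by
    intro Y; unfold earlyPotential; split_ifs
    · exact min_le_left _ _
    · exact le_rfl
  have hle1 : 𝔼 d ∈ draws s G, earlyPotential o c γ θ η A i (update X d) ≤ 1 :=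
    expect_le hne fun d _ => h1 _
  have hAi : 0 ≤ A + i * η := by positivity
  -- Common to both phases: `P` is an exceptional event of probability at most `η`, off which the
  -- next lead meets the threshold for `i`.
  have key : ∀ P : Config V → Prop, ∀ [DecidablePred P],
      (∀ Y, ¬ P Y → max ((1 - 2 * c) * (1 + γ)⁻¹ ^ i) θ * N ≤ lead o Y) →
      𝔼 d ∈ draws s G, (if P (update X d) then (1 : ℝ) else 0) ≤ η →
      𝔼 d ∈ draws s G, earlyPotential o c γ θ η A i (update X d) ≤ A + ((i + 1 : ℕ) : ℝ) * η := by
    intro P _ hP hPη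
    have h2 : ∀ Y : Config V, earlyPotential o c γ θ η A i Y
        ≤ (A + i * η) + if P Y then (1 : ℝ) else 0 := by
      intro Y
      by_cases hY : P Y
      · rw [if_pos hY]
        linarith [h1 Y]
      · rw [if_neg hY, earlyPotential, if_pos (hP Y hY), add_zero]
        exact min_le_right _ _
    refine (expect_le_expect fun d _ => h2 (update X d)).trans ?_
    rw [expect_add_distrib, expect_const hne]
    push_cast
    linarith
  rw [earlyPotential.eq_def o c γ θ η A (i + 1)]
  split_ifs with hX
  · refine le_min hle1 ?_
    -- A minority that is already small only has to stay small; otherwise the lead must grow. The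
    -- floor `θ` in the threshold keeps `grow` applicable.
    by_cases hb : (votes X (!o) : ℝ) ≤ c * N
    · refine key (fun Y => c * N < votes Y (!o)) (fun Y hY => ?_) (h.stay X hb)
      refine le_trans ?_ (lead_le_iff.2 (not_lt.1 hY))
      refine mul_le_mul_of_nonneg_right (max_le ?_ hθ') hN0
      refine mul_le_of_le_one_right (by linarith) (pow_le_one₀ (by positivity) ?_)
      exact inv_le_one_of_one_le₀ (by linarith)
    · refine key (fun Y => lead o Y < (1 + γ) * lead o X) (fun Y hY => ?_)
        (h.grow X (le_trans (by gcongr; exact le_max_right _ _) hX) (not_le.1 hb))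
      refine le_trans ?_ (not_lt.1 hY)
      refine le_trans ?_ (mul_le_mul_of_nonneg_left hX hγ1.le)
      rw [← mul_assoc]
      refine mul_le_mul_of_nonneg_right (max_le ?_ ?_) hN0
      · calc (1 - 2 * c) * (1 + γ)⁻¹ ^ i
            = (1 + γ) * ((1 - 2 * c) * (1 + γ)⁻¹ ^ (i + 1)) := by
              rw [pow_succ]; field_simp
          _ ≤ _ := by gcongr; exact le_max_left _ _
      · calc θ ≤ (1 + γ) * θ := by nlinarith
          _ ≤ _ := by gcongr; exact le_max_right _ _
  · exact hle1

/-- The potentials are chained backwards: the last `t - T₁ - T₂` steps use that unanimity is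
absorbing, the `T₂` before them the halving, and the first `T₁` the growth of the lead up to `(1 -
2c)n`. -/
theorem expectAt_failure_le {o : Bool} {c γ θ η : ℝ} (hc : 2 * c ≤ 1) (hγ : 0 ≤ γ)
    (hθ : 0 ≤ θ) (hθ' : θ ≤ 1 - 2 * c) (hη : 0 ≤ η) (h : RoundProgress s G o c γ θ η)
    {t T₁ T₂ : ℕ} (ht : T₁ + T₂ ≤ t) (hT₁ : (1 - 2 * c) * (1 + γ)⁻¹ ^ T₁ ≤ θ)
    (hX₀ : θ * Fintype.card V ≤ lead o X₀) :
    expectAt s G adv X₀ t (failure o)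
      ≤ ENNReal.ofReal ((1 / 2) ^ T₂ * Fintype.card V + (T₁ + T₂) * η) := by
  set A : ℝ := (1 / 2) ^ T₂ * Fintype.card V + T₂ * η with hA
  have hA0 : 0 ≤ A := by positivity
  obtain ⟨k, rfl⟩ := Nat.exists_eq_add_of_le ht
  have h1 := expectAt_add_le (s := s) (G := G) (adv := adv) (X₀ := X₀) (φ := fun _ => failure o)
    (fun _ X => by unfold failure; split_ifs <;> norm_num)
    (fun _ X Y hXY => by simp only [failure, hXY]) (fun _ X => expect_failure_le o X) (T₁ + T₂) k
  refine h1.trans ?_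
  have h2 : ∀ X : Config V, failure o X ≤ latePotential o c η 0 X := by
    intro X
    unfold failure latePotential
    split_ifs with e1 e2 e2
    · positivity
    · norm_num
    · have : (1 : ℝ) ≤ votes X (!o) := by exact_mod_cast Nat.one_le_iff_ne_zero.2 e1
      simpa using this
    · exact le_rfl
  refine (expectAt_mono h2 _).trans ?_
  refine (expectAt_add_le (φ := latePotential o c η) (fun j X => ?_) (fun j X Y hXY => ?_)
    (expect_latePotential_le hη h) T₁ T₂).trans ?_
  · unfold latePotential; split_ifs <;> positivity
  · simp only [latePotential, hXY]
  have h3 : ∀ X : Config V, latePotential o c η T₂ X ≤ earlyPotential o c γ θ η A 0 X := by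
    intro X
    have hle : latePotential o c η T₂ X ≤ 1 := by
      unfold latePotential; split_ifs
      · exact min_le_left _ _
      · exact le_rfl
    unfold earlyPotential
    split_ifs with e
    · refine le_min hle ?_
      rw [pow_zero, mul_one, max_eq_left hθ'] at e
      rw [latePotential, if_pos (lead_le_iff.1 e)]
      refine (min_le_right _ _).trans ?_
      have : (votes X (!o) : ℝ) ≤ Fintype.card V := by
        exact_mod_cast card_le_univ _
      have : (1 / 2 : ℝ) ^ T₂ * votes X (!o) ≤ (1 / 2) ^ T₂ * Fintype.card V := by gcongr
      push_cast
      linarith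
    · exact hle
  refine (expectAt_mono h3 _).trans ?_
  have h4 := expectAt_add_le (s := s) (G := G) (adv := adv) (X₀ := X₀)
    (φ := earlyPotential o c γ θ η A)
    (fun j X => by unfold earlyPotential; split_ifs <;> positivity)
    (fun j X Y hXY => by simp only [earlyPotential, lead_eq, hXY])
    (expect_earlyPotential_le hc hγ hθ hθ' hη hA0 h) 0 T₁
  rw [zero_add, expectAt_zero] at h4
  refine h4.trans (ENNReal.ofReal_le_ofReal ?_)
  rw [earlyPotential, if_pos (by rwa [max_eq_right hT₁])]
  refine (min_le_right _ _).trans (le_of_eq ?_)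
  rw [hA]
  ring

end Voting

/-! ### Choice of constants and conclusion. -/

/-- Chebyshev's inequality with the two drifts. For growth the gap between mean `(1 + c / 2)D` and
target `(1 + c / 4)D` is `cD / 4`, with `D ≥ θn`; for staying small the gap is `cn`. -/
theorem roundProgress_of_good {n d : ℕ} {G : SimpleGraph (Fin n)}
    (hG : ∀ v, (nbrs G v).card = d) (hd : 2 ≤ d) (hn : 1 ≤ n) {ε c θ η : ℝ} (hc : 0 < c)
    (hθ : 0 < θ) (hεθ : 16 * ε ≤ c * θ) (hdisc : SmallDiscrepancy d ε G)
    (hsparse : SmallSetsSparse d (17 * c) G) (hη₁ : 16 ≤ c ^ 2 * θ ^ 2 * n * η)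
    (hη₂ : 1 ≤ c ^ 2 * n * η) (s : Sampling) (o : Bool) :
    RoundProgress s G o c (c / 4) θ η := by
  classical
  have hn0 : (0 : ℝ) < n := by exact_mod_cast hn
  have hne := draws_nonempty s G
  refine ⟨fun X hX hb => ?_, fun X hb => ?_, fun X hb => ?_⟩ <;>
    rw [Fintype.card_fin] at *
  · have hlead : 0 < lead o X := lt_of_lt_of_le (by positivity) hX
    have hmean : (1 + c / 2) * lead o X ≤ ∑ v, meanSgn o s G X v := by
      refine le_sum_meanSgn_of_discrepancy hG hd hn hdisc s o X ?_ hlead.le hc.le ?_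
      · have e1 : 16 * ε * n ≤ c * θ * n := by gcongr
        have e2 : c * (θ * n) ≤ c * lead o X := by gcongr
        linarith
      · rw [lead_eq', Fintype.card_fin]
        linarith
    refine (lead_chebyshev o s G X (r := c / 4 * lead o X) (by positivity)
      (fun Y => lead o Y < (1 + c / 4) * lead o X) fun Y hY => ?_).trans ?_
    · linarith
    · rw [Fintype.card_fin, div_le_iff₀ (by positivity)]
      have hη0 : 0 ≤ η := by
        by_contra hneg
        have : c ^ 2 * n * η ≤ 0 := mul_nonpos_of_nonneg_of_nonpos (by positivity)
          (not_le.1 hneg).le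
        linarith
      have e1 : (θ * n) ^ 2 ≤ lead o X ^ 2 := by gcongr
      calc (n : ℝ) = 16 * n / 16 := by ring
        _ ≤ (c ^ 2 * θ ^ 2 * n * η) * n / 16 := by gcongr
        _ = η * (c / 4) ^ 2 * (θ * n) ^ 2 := by ring
        _ ≤ η * (c / 4) ^ 2 * lead o X ^ 2 := by gcongr
        _ = _ := by ring
  · have hmean := le_sum_meanSgn_of_sparse hG hd hsparse s o X (by linarith)
    rw [← sum_meanSgn] at hmean
    have e : ∀ Y : Config (Fin n), lead o Y = n - 2 * votes Y (!o) := by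
      intro Y; rw [lead_eq', Fintype.card_fin]
    simp only [e] at hmean
    rw [expect_sub_distrib, expect_const hne, ← mul_expect] at hmean
    linarith
  · have hmean := le_sum_meanSgn_of_sparse hG hd hsparse s o X (by linarith)
    refine (lead_chebyshev o s G X (r := c * n) (by positivity)
      (fun Y => c * n < votes Y (!o)) fun Y hY => ?_).trans ?_
    · rw [lead_eq', Fintype.card_fin]
      linarith
    · rw [Fintype.card_fin, div_le_iff₀ (by positivity)]
      calc (n : ℝ) = 1 * n := by ring
        _ ≤ (c ^ 2 * n * η) * n := by gcongr
        _ = _ := by ring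

theorem lead_eq_imbalance {n : ℕ} (hn : 1 ≤ n) {X : Config (Fin n)} {o : Bool}
    (h : votes X (!o) < votes X o) : lead o X = imbalance X * n := by
  have hn0 : (n : ℝ) ≠ 0 := by positivity
  have h' : (votes X (!o) : ℝ) < votes X o := by exact_mod_cast h
  rw [lead_eq, imbalance, Fintype.card_fin, div_mul_cancel₀ _ hn0]
  cases o
  · rw [abs_of_neg (by simpa using h')]; simp
  · rw [abs_of_pos (by simpa using h')]; simp

theorem prob_uniformOfFinset_ge {α : Type*} {R : Finset α} (hR : R.Nonempty) {E : Set α}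
    {P : α → Prop} [DecidablePred P] {δ : ℝ} (hP : ∀ a ∈ R, P a → a ∈ E)
    (hbad : ((R.filter fun a => ¬ P a).card : ℝ) ≤ δ * R.card) :
    1 - δ ≤ prob (PMF.uniformOfFinset R hR) E := by
  classical
  have hc : (0 : ℝ) < R.card := by exact_mod_cast card_pos.2 hR
  rw [prob, PMF.toOuterMeasure_uniformOfFinset_apply, ENNReal.toReal_div, ENNReal.toReal_natCast,
    ENNReal.toReal_natCast, le_div_iff₀ hc]
  have h1 : ((R.filter P).card : ℝ) ≤ (R.filter fun a => a ∈ E).card := by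
    refine Nat.cast_le.2 (card_le_card fun a ha => ?_)
    rw [mem_filter] at ha ⊢
    exact ⟨ha.1, hP a ha.1 ha.2⟩
  have h2 : ((R.filter P).card : ℝ) + (R.filter fun a => ¬ P a).card = R.card := by
    exact_mod_cast card_filter_add_card_filter_not P
  linarith

/-- By the arithmetic-geometric mean inequality; it bounds Chebyshev errors of order `1 / (nq)` by
order `1 / √n`, uniformly in `d`. -/
theorem one_div_sqrt_le {n d : ℕ} (hn : 1 ≤ n) (hd : 1 ≤ d) :
    1 / Real.sqrt n ≤ (d : ℝ) / n + 1 / d := by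
  have hn0 : (0 : ℝ) < n := by exact_mod_cast hn
  have hd0 : (0 : ℝ) < d := by exact_mod_cast hd
  have hs : 0 < Real.sqrt n := Real.sqrt_pos.2 hn0
  have hsq : Real.sqrt n * Real.sqrt n = n := Real.mul_self_sqrt hn0.le
  rw [div_add_div _ _ hn0.ne' hd0.ne', div_le_div_iff₀ hs (by positivity)]
  nlinarith [sq_nonneg ((d : ℝ) - Real.sqrt n), mul_pos hs hd0]

theorem prob_unanimous_of_good {n d : ℕ} {G : SimpleGraph (Fin n)}
    (hG : ∀ v, (nbrs G v).card = d) (hd : 1 ≤ d) (hn : 3 ≤ n)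
    (hδ : 4e16 * Real.sqrt ((d : ℝ) / n + 1 / d) ≤ 1)
    (hdisc : SmallDiscrepancy d (64 * Real.sqrt ((d : ℝ) / n + 1 / d)) G)
    (hsparse : SmallSetsSparse d 1e-11 G) (s : Sampling) {X₀ : Config (Fin n)} {o : Bool}
    (hX₀ : votes X₀ (!o) < votes X₀ o)
    (himb : 4e16 * Real.sqrt ((d : ℝ) / n + 1 / d) ≤ imbalance X₀) (adv : Adversary (Fin n))
    {ℓ : ℝ} (hℓ : ℓ = 1 / Real.log (1 + 1e-13 / 4)) {t : ℕ}
    (ht : 3 * (ℓ + 1) * Real.log n ≤ t) :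
    1 - (1 / n + 3 * (ℓ + 1) * Real.log n * (1e26 / Real.sqrt n))
      ≤ prob (votingLaw s G adv X₀ t) {p | ∀ v, p.2 v = o} := by
  have hn0 : (0 : ℝ) < n := by positivity
  have hn3 : (3 : ℝ) ≤ n := by exact_mod_cast hn
  have hd0 : (0 : ℝ) < d := by exact_mod_cast hd
  set q := (d : ℝ) / n + 1 / d with hq
  have hq0 : 0 < q := by positivity
  set δ := Real.sqrt q with hδdef
  have hδ0 : 0 < δ := Real.sqrt_pos.2 hq0
  have hδsq : δ ^ 2 = q := Real.sq_sqrt hq0.le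
  have hqn : 1 / Real.sqrt n ≤ q := one_div_sqrt_le (by omega) hd
  have hsn : 0 < Real.sqrt n := Real.sqrt_pos.2 hn0
  have hsn2 : Real.sqrt n * Real.sqrt n = n := Real.mul_self_sqrt hn0.le
  have hsn1 : 1 ≤ Real.sqrt n := Real.one_le_sqrt.2 (by linarith)
  norm_num at hδ himb
  have hd2 : 2 ≤ d := by
    by_contra h
    have : d = 1 := by omega
    have h1 : 1 ≤ q := by
      rw [hq, this]
      have : 0 < ((1 : ℕ) : ℝ) / n := by positivity
      norm_num at this ⊢
    nlinarith
  -- With `c = 1e-13`, `17c ≤ 1e-11` fits the sparsity bound, and `θ = 2e16 δ` gives `16 * 64δ ≤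
  -- cθ`. The factor `1e26` is `c ^ (-2)`.
  have hprog : RoundProgress s G o 1e-13 (1e-13 / 4) (2e16 * δ) (1e26 / Real.sqrt n) := by
    refine roundProgress_of_good hG hd2 (by omega) (ε := 64 * δ) (by norm_num) (by positivity) ?_
      hdisc ?_ ?_ ?_ s o
    · norm_num; linarith
    · intro U hU
      refine hsparse U (hU.trans ?_)
      norm_num
      linarith
    · have e : (1e-13 : ℝ) ^ 2 * (2e16 * δ) ^ 2 * n * (1e26 / Real.sqrt n)
          = 4e32 * (q * Real.sqrt n) := by
        rw [mul_pow, hδsq]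
        nth_rewrite 1 [← hsn2]
        field_simp
        norm_num
      rw [e]
      rw [div_le_iff₀ hsn] at hqn
      norm_num
      linarith
    · have e : (1e-13 : ℝ) ^ 2 * n * (1e26 / Real.sqrt n) = Real.sqrt n := by
        nth_rewrite 1 [← hsn2]
        field_simp
        norm_num
      rw [e]
      exact hsn1
  set γ : ℝ := 1e-13 / 4 with hγ
  have hγ0 : 0 < γ := by norm_num [hγ]
  have hγ1 : γ ≤ 1 := by norm_num [hγ]
  have hlogγ : 0 < Real.log (1 + γ) := Real.log_pos (by linarith)
  have hlogn : 1 ≤ Real.log n := by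
    rw [Real.le_log_iff_exp_le hn0]
    linarith [Real.exp_one_lt_d9]
  have hℓ0 : 0 < ℓ := by rw [hℓ]; positivity
  -- After `T` growth steps `(1 + γ) ^ (-T) ≤ 1 / n`; the `2T` halving steps then leave `n * (1 / 2)
  -- ^ (2T) ≤ 1 / n`, as `1 + γ ≤ 2`. Hence the `3` in the time bound.
  set T := ⌈ℓ * Real.log n⌉₊ with hT
  have hT1 : ℓ * Real.log n ≤ T := Nat.le_ceil _
  have hT2 : (T : ℝ) ≤ (ℓ + 1) * Real.log n := by
    have := Nat.ceil_lt_add_one (a := ℓ * Real.log n) (by positivity)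
    rw [← hT] at this
    linarith
  have hpow : (1 + γ)⁻¹ ^ T ≤ 1 / n := by
    rw [inv_pow, one_div]
    gcongr
    rw [← Real.log_le_log_iff hn0 (by positivity), Real.log_pow]
    have e : ℓ * Real.log (1 + γ) = 1 := by rw [hℓ]; field_simp
    have := mul_le_mul_of_nonneg_right hT1 hlogγ.le
    calc Real.log n = ℓ * Real.log (1 + γ) * Real.log n := by rw [e, one_mul]
      _ = ℓ * Real.log n * Real.log (1 + γ) := by ring
      _ ≤ _ := this
  have hhalf : (1 / 2 : ℝ) ^ (2 * T) ≤ (1 / n) ^ 2 := by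
    calc (1 / 2 : ℝ) ^ (2 * T) ≤ (1 + γ)⁻¹ ^ (2 * T) := by
          gcongr
          rw [one_div]
          gcongr
          linarith
      _ = ((1 + γ)⁻¹ ^ T) ^ 2 := by rw [mul_comm, pow_mul]
      _ ≤ _ := by gcongr
  have hnδ : 1 / (n : ℝ) ≤ 2e16 * δ := by
    have e1 : 1 / (n : ℝ) ≤ 1 / Real.sqrt n := by
      gcongr
      nlinarith
    have e2 : q ≤ δ := by rw [← hδsq]; nlinarith
    norm_num
    rw [← one_div]
    linarith
  have hfail := expectAt_failure_le (adv := adv) (X₀ := X₀) (t := t) (T₁ := T) (T₂ := 2 * T)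
    (by norm_num) hγ0.le (by positivity) (by norm_num; linarith) (by positivity) hprog
    (by
      have : ((T + 2 * T : ℕ) : ℝ) ≤ t := by push_cast; linarith
      exact_mod_cast this)
    (by
      refine le_trans ?_ hnδ
      refine le_trans (mul_le_of_le_one_left (by positivity) (by norm_num)) hpow)
    (by
      rw [Fintype.card_fin, lead_eq_imbalance (by omega) hX₀]
      gcongr
      norm_num
      linarith)
  refine le_trans ?_ (prob_unanimous_ge (by positivity) hfail)
  rw [Fintype.card_fin]
  push_cast
  have e1 : (1 / 2 : ℝ) ^ (2 * T) * n ≤ 1 / n := by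
    calc (1 / 2 : ℝ) ^ (2 * T) * n ≤ (1 / n) ^ 2 * n := by gcongr
      _ = 1 / n := by field_simp
  have e2 : ((T : ℝ) + 2 * T) * (1e26 / Real.sqrt n)
      ≤ 3 * (ℓ + 1) * Real.log n * (1e26 / Real.sqrt n) := by
    gcongr
    linarith
  linarith

theorem tendsto_errorBound (a b : ℝ) :
    Filter.Tendsto (fun n : ℕ => if n < 3 then (1 : ℝ)
      else 6 / n + b * Real.log n * (a / Real.sqrt n)) Filter.atTop (nhds 0) := by
  have h1 : Filter.Tendsto (fun n : ℕ => 6 / (n : ℝ)) Filter.atTop (nhds 0) :=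
    tendsto_const_div_atTop_nhds_zero_nat 6
  have h2 : Filter.Tendsto (fun n : ℕ => Real.log n / (n : ℝ) ^ (1 / 2 : ℝ)) Filter.atTop
      (nhds 0) :=
    ((isLittleO_log_rpow_atTop (by norm_num : (0 : ℝ) < 1 / 2)).tendsto_div_nhds_zero).comp
      tendsto_natCast_atTop_atTop
  have h3 := h1.add (h2.const_mul (b * a))
  rw [mul_zero, add_zero] at h3
  refine h3.congr' ?_
  filter_upwards [Filter.eventually_ge_atTop 3] with n hn
  rw [if_neg (by omega), ← Real.sqrt_eq_rpow]
  ring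

end TwoSampleVoting

theorem theorem1 :
    ∃ (K C : ℝ) (ε : ℕ → ℝ), 0 < K ∧ 0 < C ∧ Filter.Tendsto ε Filter.atTop (nhds 0) ∧
      ∀ (s : TwoSampleVoting.Sampling) (n d : ℕ) (_ : 1 ≤ d)
        (h : (TwoSampleVoting.regularGraphs n d).Nonempty),
        1 - ε n ≤ TwoSampleVoting.prob (TwoSampleVoting.randomRegularGraph n d h)
          {G | ∀ (X₀ : TwoSampleVoting.Config (Fin n)) (o : Bool),
            TwoSampleVoting.votes X₀ (!o) < TwoSampleVoting.votes X₀ o →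
            K * Real.sqrt ((d : ℝ) / (n : ℝ) + 1 / (d : ℝ)) ≤ TwoSampleVoting.imbalance X₀ →
            ∀ (adv : TwoSampleVoting.Adversary (Fin n)) (t : ℕ), C * Real.log (n : ℝ) ≤ (t : ℝ) →
              1 - ε n ≤ TwoSampleVoting.prob (TwoSampleVoting.votingLaw s G adv X₀ t)
                {p | ∀ v, p.2 v = o}} := by
  classical
  obtain ⟨ℓ, hℓ⟩ : ∃ ℓ : ℝ, ℓ = 1 / Real.log (1 + 1e-13 / 4) := ⟨_, rfl⟩
  have hℓ0 : 0 < ℓ := by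
    rw [hℓ]
    have : 0 < Real.log (1 + 1e-13 / 4) := Real.log_pos (by norm_num)
    positivity
  refine ⟨4e16, 3 * (ℓ + 1), fun n => if n < 3 then (1 : ℝ)
      else 6 / n + 3 * (ℓ + 1) * Real.log n * (1e26 / Real.sqrt n), by norm_num, by positivity,
      TwoSampleVoting.tendsto_errorBound _ _, fun s n d hd h => ?_⟩
  -- For `n < 3` the error is set to `1`; for `n ≥ 3` one has `log n ≥ 1`, which absorbs the
  -- rounding of `T`.
  by_cases hn : n < 3
  · simp only [if_pos hn, sub_self]
    exact ENNReal.toReal_nonneg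
  simp only [if_neg hn]
  have hn3 : 3 ≤ n := not_lt.1 hn
  have hn0 : (0 : ℝ) < n := by positivity
  have hlog : 0 ≤ Real.log n := Real.log_natCast_nonneg n
  have hB : 0 ≤ 3 * (ℓ + 1) * Real.log n * (1e26 / Real.sqrt n) := by positivity
  by_cases hδ : 4e16 * Real.sqrt ((d : ℝ) / n + 1 / d) ≤ 1
  · have hbad := TwoSampleVoting.card_not_good (n := n) hd (by omega) (by
      norm_num at hδ ⊢
      linarith [Real.sqrt_nonneg ((d : ℝ) / n + (d : ℝ)⁻¹)])
    refine le_trans (by linarith) (TwoSampleVoting.prob_uniformOfFinset_ge h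
      (fun G hG hgood => ?_) hbad)
    intro X₀ o hX₀ himb adv t ht
    have := TwoSampleVoting.prob_unanimous_of_good (TwoSampleVoting.mem_regularGraphs.1 hG) hd hn3 hδ
      hgood.1 hgood.2 s hX₀ himb adv hℓ ht
    refine le_trans ?_ this
    have : 1 / (n : ℝ) ≤ 6 / n := by gcongr; norm_num
    linarith
  -- Here the required imbalance exceeds `1`, so no configuration qualifies and every graph has the
  -- property.
  · refine le_trans (by linarith [div_nonneg (by norm_num : (0 : ℝ) ≤ 6) hn0.le])
      (TwoSampleVoting.prob_uniformOfFinset_ge (P := fun _ => True) (δ := 0) h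
        (fun G _ _ => ?_) (by simp))
    intro X₀ o hX₀ himb
    have h1 := TwoSampleVoting.lead_eq_imbalance (by omega) hX₀
    have h2 := (abs_le.1 (TwoSampleVoting.abs_lead_le o X₀)).2
    rw [h1] at h2
    have h3 : TwoSampleVoting.imbalance X₀ ≤ 1 := by
      by_contra hcon
      nlinarith [not_le.1 hcon]
    exact absurd (himb.trans h3) hδ
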